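/- **Setting.** Let $\mathcal B\neq\{0\}$ be a complex Banach space of functions $f:\mathbb X\to\mathbb C$ on a measurable space $\mathbb X$ (or of classes of such functions modulo a nonnegative nonnull measure $\mathbf m$) which is a complex Banach lattice: it is stable under $f\mapsto |f|$ and $f\mapsto \mathrm{Re} f$, under $\min$ and $\max$ of real-valued elements, and $|f|\le |g|$ implies $\|f\|\le\|g\|$. Relations such as $f\ge 0$, $f>0$ are understood everywhere on $\mathbb X$ (respectively $\mathbf m$-almost everywhere). A continuous linear form $\psi\in\mathcal B^*$ is nonnegative if $\psi(f)\ge0$ for all $f\ge 0$, and positive if $\psi(f)>0$ for all nonnull $f\ge0$. For a bounded operator $Q$ on $\mathcal B$, $r(Q)$ is its spectral radius; $Q$ is quasi-compact if $r_{ess}(Q)<r(Q)$, where $r_{ess}(Q)=\lim_n \inf_{F\text{ compact}}\|Q^n-F\|^{1/n}$. **Proposition (first order of the spectral radius).** Let $Q$ be a nonnegative (i.e. $f\ge0\Rightarrow Qf\ge0$) quasi-compact bounded operator on $\mathcal B$ with $r(Q)\ne0$, such that for every nonnull nonnegative $f\in\mathcal B$ we have $Qf>0$, and $\psi(Qf)>0$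 for every nonnull nonnegative $\psi\in\mathcal B^*$ with $Q^*\psi=r(Q)\psi$. Then: 1. $r(Q)$ is a pole of order one of the resolvent $z\mapsto (zI-Q)^{-1}$, and there exist a positive $\phi\in\mathcal B$ and a positive $\psi\in\mathcal B^*$ with $\psi(\phi)=1$, $Q\phi=r(Q)\phi$ and $Q^*\psi=r(Q)\psi$. 2. If $\lambda\in\mathbb C$ and $h\in\mathcal B$ satisfy $|\lambda|=r(Q)$ and $Qh=\lambda h$, then $Q|h|=r(Q)|h|$. 3. Let moreover $P$ be a Markov kernel on $\mathbb X$ with invariant probability measure $\pi$, $\xi:\mathbb X\to[0,+\infty)$ measurable and $\gamma\in[0,+\infty]$, and assume that $Q=P(e^{-\gamma\xi}\,\cdot)$, i.e. $(Qf)(x)=\int f(y)e^{-\gamma\xi(y)}P(x,dy)$ for all $f\in\mathcal B$ (with $e^{-\infty\cdot\xi}:=\mathbf 1_{\{\xi=0\}}$), that $\mathbf 1_{\mathbb X}\in\mathcal B$, that $\mathcal B$ is continuously included in $\mathbb L^1(\pi)$, that $\ker(Q-r(Q)I)=\mathbb C\cdot\phi$ for some positive $\phi\in\mathcal B$, and that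 $1$ is the only complex number $\lambda$ of modulus $1$ such that $P(h/|h|)=\lambda\,h/|h|$ in $\mathbb L^1(\pi)$ for some $h\in\mathcal B$ with $|h|>0$. Then $r(Q)$ is the only eigenvalue of $Q$ of modulus $r(Q)$. -/

import Mathlib

open Filter MeasureTheory ProbabilityTheory
open scoped ENNReal NNReal ComplexOrder

/-- A complex Banach space `B` of functions `X → ℂ` modulo equality along the filter `l`, which is a
complex Banach lattice. For `l = ⊤` the elements of `B` are functions on `X`; for `l = ae m` they are
classes of functions modulo the measure `m`. (Completeness of `B` is a separate `CompleteSpace`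
argument wherever this is used.) -/
structure FunctionLattice {X : Type*} (l : Filter X) (B : Type*)
    [NormedAddCommGroup B] [NormedSpace ℂ B] where
  /-- the inclusion of `B` into the space of all functions modulo equality along `l` -/
  toGerm : B →ₗ[ℂ] Germ l ℂ
  toGerm_injective : Function.Injective toGerm
  /-- stability by modulus -/
  abs_mem : ∀ f : B, ∃ g : B, toGerm g = (toGerm f).map fun z : ℂ => ((‖z‖ : ℝ) : ℂ)
  /-- stability by real part -/
  re_mem : ∀ f : B, ∃ g : B, toGerm g = (toGerm f).map fun z : ℂ => ((z.re : ℝ) : ℂ)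
  /-- stability of the real-valued elements by minimum -/
  min_mem : ∀ f g : B, (toGerm f).LiftPred (fun z => z.im = 0) →
    (toGerm g).LiftPred (fun z => z.im = 0) →
    ∃ k : B, toGerm k = (toGerm f).map₂ (fun z w : ℂ => ((min z.re w.re : ℝ) : ℂ)) (toGerm g)
  /-- stability of the real-valued elements by maximum -/
  max_mem : ∀ f g : B, (toGerm f).LiftPred (fun z => z.im = 0) →
    (toGerm g).LiftPred (fun z => z.im = 0) →
    ∃ k : B, toGerm k = (toGerm f).map₂ (fun z w : ℂ => ((max z.re w.re : ℝ) : ℂ)) (toGerm g)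
  /-- `|f| ≤ |g|` implies `‖f‖ ≤ ‖g‖` -/
  norm_mono : ∀ f g : B, (toGerm f).LiftRel (fun z w : ℂ => ‖z‖ ≤ ‖w‖) (toGerm g) → ‖f‖ ≤ ‖g‖

namespace FunctionLattice

variable {X : Type*} {l : Filter X} {B : Type*} [NormedAddCommGroup B] [NormedSpace ℂ B]

/-- The modulus `|f|`, as an element of `B`. -/
noncomputable def abs (L : FunctionLattice l B) (f : B) : B := Classical.choose (L.abs_mem f)

theorem toGerm_abs (L : FunctionLattice l B) (f : B) :
    L.toGerm (L.abs f) = (L.toGerm f).map fun z : ℂ => ((‖z‖ : ℝ) : ℂ) :=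
  Classical.choose_spec (L.abs_mem f)

/-- The function `u` is (a representative of) the element `f` of `B`. -/
def IsRep (L : FunctionLattice l B) (f : B) (u : X → ℂ) : Prop := L.toGerm f = (u : Germ l ℂ)

/-- `f ≥ 0` in `B` (in particular `f` is real-valued). -/
def IsNonneg (L : FunctionLattice l B) (f : B) : Prop := (L.toGerm f).LiftPred fun z => 0 ≤ z

/-- `f > 0` in `B`: everywhere on `X` if `l = ⊤`, almost everywhere if `l = ae m`. -/
def IsPos (L : FunctionLattice l B) (f : B) : Prop := (L.toGerm f).LiftPred fun z => 0 < z

/-- A nonnegative element of the topological dual of `B`. -/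
def IsNonnegDual (L : FunctionLattice l B) (ψ : B →L[ℂ] ℂ) : Prop :=
  ∀ f : B, L.IsNonneg f → 0 ≤ ψ f

/-- A positive element of the topological dual of `B`. -/
def IsPosDual (L : FunctionLattice l B) (ψ : B →L[ℂ] ℂ) : Prop :=
  ∀ f : B, L.IsNonneg f → f ≠ 0 → 0 < ψ f

/-- A nonnegative operator on `B`. -/
def IsNonnegOperator (L : FunctionLattice l B) (Q : B →L[ℂ] B) : Prop :=
  ∀ f : B, L.IsNonneg f → L.IsNonneg (Q f)

end FunctionLattice

/-- The spectral radius of a bounded operator, as a real number. -/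
noncomputable def specRadius {B : Type*} [NormedAddCommGroup B] [NormedSpace ℂ B]
    (Q : B →L[ℂ] B) : ℝ := (spectralRadius ℂ Q).toReal

/-- The essential spectral radius `lim_n (inf_F ‖Q ^ n - F‖) ^ (1 / n)`, the infimum being over all
compact operators `F` on `B`. (The limit exists by submultiplicativity, so it is the `limsup`.) -/
noncomputable def essSpectralRadius {B : Type*} [NormedAddCommGroup B] [NormedSpace ℂ B]
    (Q : B →L[ℂ] B) : ℝ≥0∞ :=
  limsup (fun n : ℕ =>
    (⨅ F : {F : B →L[ℂ] B // IsCompactOperator F}, ‖Q ^ n - F.1‖ₑ) ^ (1 / (n : ℝ))) atTop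

/-- Quasi-compactness: the essential spectral radius is less than the spectral radius. -/
def IsQuasiCompact {B : Type*} [NormedAddCommGroup B] [NormedSpace ℂ B] (Q : B →L[ℂ] B) : Prop :=
  essSpectralRadius Q < spectralRadius ℂ Q

/-- `z₀` is a pole of order `q` of `Q`, i.e. of the resolvent function `z ↦ (z I - Q)⁻¹`. -/
def IsPoleOfOrder {B : Type*} [NormedAddCommGroup B] [NormedSpace ℂ B]
    (Q : B →L[ℂ] B) (z₀ : ℂ) (q : ℕ) : Prop :=
  0 < q ∧ MeromorphicAt (fun z : ℂ => resolvent Q z) z₀ ∧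
    meromorphicOrderAt (fun z : ℂ => resolvent Q z) z₀ = ((-(q : ℤ) : ℤ) : WithTop ℤ)

/-- The number `e ^ (- γ t)` for `γ ∈ [0, ∞]` and `t ∈ [0, ∞)`; for `γ = ∞` it is `1` if `t = 0` and
`0` otherwise. -/
noncomputable def laplaceWeight (γ : ℝ≥0∞) (t : ℝ≥0) : ℝ :=
  if γ = ∞ then (if t = 0 then 1 else 0) else Real.exp (-(γ.toReal * t))

/-- `Q = P (e ^ (- γ ξ) ·)` on `B`: for every `f` in `B`, the function
`x ↦ ∫ f(y) e ^ (- γ ξ(y)) P(x, dy)` is well defined in `B` (the integrals converge, and the result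
does not depend on the representative of `f`) and equals `Q f`. -/
def IsLaplaceOperator {X : Type*} [MeasurableSpace X] {l : Filter X} {B : Type*}
    [NormedAddCommGroup B] [NormedSpace ℂ B] (L : FunctionLattice l B) (Q : B →L[ℂ] B)
    (P : Kernel X X) (ξ : X → ℝ≥0) (γ : ℝ≥0∞) : Prop :=
  ∀ (f : B) (u : X → ℂ), L.IsRep f u →
    (∀ᶠ x in l, Integrable (fun y => (laplaceWeight γ (ξ y) : ℂ) * u y) (P x)) ∧
    L.IsRep (Q f) (fun x => ∫ y, (laplaceWeight γ (ξ y) : ℂ) * u y ∂(P x))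

/-- `B` is continuously included in `L¹(π)`: sending `f` to its class modulo `π` is a well-defined
bounded linear map from `B` to `L¹(π)`. -/
def ContinuouslyIncludedInL1 {X : Type*} [MeasurableSpace X] {l : Filter X} {B : Type*}
    [NormedAddCommGroup B] [NormedSpace ℂ B] (L : FunctionLattice l B) (π : Measure X) : Prop :=
  ∃ C : ℝ, ∀ (f : B) (u : X → ℂ), L.IsRep f u → Integrable u π ∧ ∫ x, ‖u x‖ ∂π ≤ C * ‖f‖

/-- `P (h / |h|) = lam h / |h|` in `L¹(π)` for some `h` in `B` with `|h| > 0`. -/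
def IsUnimodularEigenvalue {X : Type*} [MeasurableSpace X] {l : Filter X} {B : Type*}
    [NormedAddCommGroup B] [NormedSpace ℂ B] (L : FunctionLattice l B) (P : Kernel X X)
    (π : Measure X) (lam : ℂ) : Prop :=
  ∃ (h : B) (u : X → ℂ), L.IsRep h u ∧ L.IsPos (L.abs h) ∧
    ∀ᵐ x ∂π, ∫ y, u y / (‖u y‖ : ℂ) ∂(P x) = lam * (u x / (‖u x‖ : ℂ))

/-! The existence part is a Krein–Rutman argument. Write r for r(Q) and R(z) for the resolvent. R
blows up near a spectral value of maximal modulus. The Neumann series and |Qf| ≤ Q|f| give ‖R(z)f‖ ≤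
‖R(|z|)|f|‖, so R also blows up at r, and does so on nonnegative vectors. The normalised images are
nonnegative approximate eigenvectors for r. By quasi-compactness some Q^m is a compact operator plus
one of norm less than r^m, so a subsequence converges to an eigenvector (`exists_eigenvector`). A
dual argument with ultrafilter limits gives an eigenform (`exists_eigenform`). The hypotheses on Qf
make both positive.

Given a positive eigenform ψ, the vector Q|h| - r|h| is nonnegative and killed by ψ, hence zero
(`map_abs_eq`). Moreover ψ vanishes on no nonzero eigenvector for r, so r is not in the spectrum of
T = Q - r ψ(·)φ. The resolvent of Q is explicit in terms of that of T and shows the simple pole.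

For the last claim, Qu = lam u together with Q|u| = r|u| is an equality case of |∫ f| ≤ ∫ |f|: up to
the weight, u has a phase that is constant P(x, ·)-almost everywhere and determined by u(x). Strict
positivity of Q makes P(x, ·) charge every nonnull sector of phases. Hence u/|u| converges along `l`
to c * (r / lam) for a cluster value c, and so lam = r. -/

namespace FunctionLattice

/-! ### Order structure of the lattice: representatives, the closed positive cone, nonnegative
operators and forms. -/

variable {X : Type*} {l : Filter X} {B : Type*} [NormedAddCommGroup B] [NormedSpace ℂ B]

/-- A chosen representative of an element of `B`. -/
noncomputable def rep (L : FunctionLattice l B) (f : B) : X → ℂ :=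
  Classical.choose (Quotient.exists_rep (L.toGerm f))

theorem toGerm_eq_rep (L : FunctionLattice l B) (f : B) :
    L.toGerm f = (L.rep f : Germ l ℂ) :=
  (Classical.choose_spec (Quotient.exists_rep (L.toGerm f))).symm

theorem isRep_iff (L : FunctionLattice l B) {f : B} {u : X → ℂ} :
    L.IsRep f u ↔ L.rep f =ᶠ[l] u := by
  rw [IsRep, toGerm_eq_rep, Germ.coe_eq]

theorem isRep_rep (L : FunctionLattice l B) (f : B) : L.IsRep f (L.rep f) := L.toGerm_eq_rep f

theorem ext_rep (L : FunctionLattice l B) {f g : B} (h : L.rep f =ᶠ[l] L.rep g) : f = g :=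
  L.toGerm_injective (by rw [toGerm_eq_rep, toGerm_eq_rep, Germ.coe_eq]; exact h)

theorem rep_add (L : FunctionLattice l B) (f g : B) :
    L.rep (f + g) =ᶠ[l] fun x => L.rep f x + L.rep g x := by
  rw [← isRep_iff, IsRep, map_add, toGerm_eq_rep, toGerm_eq_rep]; rfl

theorem rep_sub (L : FunctionLattice l B) (f g : B) :
    L.rep (f - g) =ᶠ[l] fun x => L.rep f x - L.rep g x := by
  rw [← isRep_iff, IsRep, map_sub, toGerm_eq_rep, toGerm_eq_rep]; rfl

theorem rep_neg (L : FunctionLattice l B) (f : B) :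
    L.rep (-f) =ᶠ[l] fun x => -L.rep f x := by
  rw [← isRep_iff, IsRep, map_neg, toGerm_eq_rep]; rfl

theorem rep_smul (L : FunctionLattice l B) (c : ℂ) (f : B) :
    L.rep (c • f) =ᶠ[l] fun x => c * L.rep f x := by
  rw [← isRep_iff, IsRep, map_smul, toGerm_eq_rep]; rfl

theorem rep_zero (L : FunctionLattice l B) : L.rep 0 =ᶠ[l] fun _ => 0 := by
  rw [← isRep_iff, IsRep, map_zero]; rfl

theorem eq_zero_of_rep (L : FunctionLattice l B) {f : B} (h : ∀ᶠ x in l, L.rep f x = 0) :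
    f = 0 :=
  L.ext_rep (EventuallyEq.trans (h : L.rep f =ᶠ[l] fun _ => 0) L.rep_zero.symm)

theorem rep_abs (L : FunctionLattice l B) (f : B) :
    L.rep (L.abs f) =ᶠ[l] fun x => ((‖L.rep f x‖ : ℝ) : ℂ) := by
  rw [← isRep_iff, IsRep, toGerm_abs, toGerm_eq_rep]; rfl

theorem norm_le_of_rep (L : FunctionLattice l B) {f g : B}
    (h : ∀ᶠ x in l, ‖L.rep f x‖ ≤ ‖L.rep g x‖) : ‖f‖ ≤ ‖g‖ := by
  apply L.norm_mono
  rw [toGerm_eq_rep, toGerm_eq_rep, Germ.liftRel_coe]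
  exact h

theorem norm_abs (L : FunctionLattice l B) (f : B) : ‖L.abs f‖ = ‖f‖ := by
  apply le_antisymm <;> apply L.norm_le_of_rep <;> filter_upwards [L.rep_abs f] with x hx <;>
    simp [hx]

/-- The real part `Re f`, as an element of `B`. -/
noncomputable def re (L : FunctionLattice l B) (f : B) : B := Classical.choose (L.re_mem f)

theorem rep_re (L : FunctionLattice l B) (f : B) :
    L.rep (L.re f) =ᶠ[l] fun x => (((L.rep f x).re : ℝ) : ℂ) := by
  rw [← isRep_iff, IsRep, re, Classical.choose_spec (L.re_mem f), toGerm_eq_rep]; rfl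

theorem exists_pos (L : FunctionLattice l B) (f : B) :
    ∃ g : B, L.rep g =ᶠ[l] fun x => ((max (L.rep f x).re 0 : ℝ) : ℂ) := by
  have h0 : (L.toGerm 0).LiftPred (fun z => z.im = 0) := by
    rw [toGerm_eq_rep, Germ.liftPred_coe]
    filter_upwards [L.rep_zero] with x hx
    simp [hx]
  have h1 : (L.toGerm (L.re f)).LiftPred (fun z => z.im = 0) := by
    rw [toGerm_eq_rep, Germ.liftPred_coe]
    filter_upwards [L.rep_re f] with x hx
    simp [hx]
  obtain ⟨k, hk⟩ := L.max_mem _ _ h1 h0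
  refine ⟨k, ?_⟩
  rw [toGerm_eq_rep, toGerm_eq_rep, toGerm_eq_rep, Germ.map₂_coe, Germ.coe_eq] at hk
  filter_upwards [hk, L.rep_zero, L.rep_re f] with x h1 h2 h3
  rw [h1, h2, h3]
  simp

/-- The positive part of `Re f`, as an element of `B`. -/
noncomputable def pos (L : FunctionLattice l B) (f : B) : B := Classical.choose (L.exists_pos f)

theorem rep_pos (L : FunctionLattice l B) (f : B) :
    L.rep (L.pos f) =ᶠ[l] fun x => ((max (L.rep f x).re 0 : ℝ) : ℂ) :=
  Classical.choose_spec (L.exists_pos f)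

theorem isNonneg_iff (L : FunctionLattice l B) {f : B} :
    L.IsNonneg f ↔ ∀ᶠ x in l, 0 ≤ L.rep f x := by
  rw [IsNonneg, toGerm_eq_rep, Germ.liftPred_coe]

theorem isPos_iff (L : FunctionLattice l B) {f : B} :
    L.IsPos f ↔ ∀ᶠ x in l, 0 < L.rep f x := by
  rw [IsPos, toGerm_eq_rep, Germ.liftPred_coe]

theorem isNonneg_abs (L : FunctionLattice l B) (f : B) : L.IsNonneg (L.abs f) := by
  rw [isNonneg_iff]
  filter_upwards [L.rep_abs f] with x hx
  rw [hx]
  exact_mod_cast norm_nonneg _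

theorem isNonneg_pos (L : FunctionLattice l B) (f : B) : L.IsNonneg (L.pos f) := by
  rw [isNonneg_iff]
  filter_upwards [L.rep_pos f] with x hx
  rw [hx]
  exact_mod_cast le_max_right _ _

theorem IsNonneg.add {L : FunctionLattice l B} {f g : B} (hf : L.IsNonneg f)
    (hg : L.IsNonneg g) : L.IsNonneg (f + g) := by
  rw [isNonneg_iff] at *
  filter_upwards [hf, hg, L.rep_add f g] with x h1 h2 h3
  rw [h3]
  exact add_nonneg h1 h2

theorem IsNonneg.smul {L : FunctionLattice l B} {f : B} (hf : L.IsNonneg f) {c : ℝ}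
    (hc : 0 ≤ c) : L.IsNonneg ((c : ℂ) • f) := by
  rw [isNonneg_iff] at *
  filter_upwards [hf, L.rep_smul c f] with x h1 h3
  rw [h3]
  exact mul_nonneg (by exact_mod_cast hc) h1

theorem isNonneg_zero (L : FunctionLattice l B) : L.IsNonneg (0 : B) := by
  rw [isNonneg_iff]
  filter_upwards [L.rep_zero] with x hx
  rw [hx]

/-- The elements of `B` with nonnegative real part. -/
def ReNonneg (L : FunctionLattice l B) (f : B) : Prop := ∀ᶠ x in l, 0 ≤ (L.rep f x).re

theorem IsNonneg.reNonneg {L : FunctionLattice l B} {f : B} (hf : L.IsNonneg f) :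
    L.ReNonneg f := by
  rw [isNonneg_iff] at hf
  exact hf.mono fun x hx => (Complex.nonneg_iff.1 hx).1

theorem ReNonneg.add {L : FunctionLattice l B} {f g : B} (hf : L.ReNonneg f)
    (hg : L.ReNonneg g) : L.ReNonneg (f + g) := by
  filter_upwards [hf, hg, L.rep_add f g] with x h1 h2 h3
  rw [h3, Complex.add_re]
  exact add_nonneg h1 h2

theorem ReNonneg.smul {L : FunctionLattice l B} {f : B} (hf : L.ReNonneg f) {c : ℝ}
    (hc : 0 ≤ c) : L.ReNonneg ((c : ℂ) • f) := by
  filter_upwards [hf, L.rep_smul c f] with x h1 h3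
  rw [h3, Complex.re_ofReal_mul]
  exact mul_nonneg hc h1

theorem isNonneg_re_iff (L : FunctionLattice l B) {f : B} :
    L.IsNonneg (L.re f) ↔ L.ReNonneg f := by
  rw [isNonneg_iff, ReNonneg]
  refine eventually_congr ?_
  filter_upwards [L.rep_re f] with x hx
  rw [hx, Complex.zero_le_real]

/-- The complex order also requires a vanishing imaginary part, which amounts to two real-part
inequalities. Closedness and separation thus need to be proved only for the cone `ReNonneg`. -/
theorem isNonneg_iff_reNonneg (L : FunctionLattice l B) {f : B} :
    L.IsNonneg f ↔
      L.ReNonneg f ∧ L.ReNonneg (Complex.I • f) ∧ L.ReNonneg ((-Complex.I) • f) := by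
  rw [isNonneg_iff]
  constructor
  · intro h
    refine ⟨?_, ?_, ?_⟩
    · exact h.mono fun x hx => (Complex.nonneg_iff.1 hx).1
    · filter_upwards [h, L.rep_smul Complex.I f] with x h1 h2
      have := (Complex.nonneg_iff.1 h1).2
      rw [h2]; simp [← this]
    · filter_upwards [h, L.rep_smul (-Complex.I) f] with x h1 h2
      have := (Complex.nonneg_iff.1 h1).2
      rw [h2]; simp [← this]
  · rintro ⟨h1, h2, h3⟩
    filter_upwards [h1, h2, h3, L.rep_smul Complex.I f, L.rep_smul (-Complex.I) f]
      with x h1 h2 h3 h4 h5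
    rw [h4] at h2
    rw [h5] at h3
    simp at h2 h3
    exact Complex.nonneg_iff.2 ⟨h1, le_antisymm h3 h2⟩

/-- The negative part of Re f is bounded pointwise by |f - g| whenever Re g ≥ 0, so its norm is at
most the distance from f to the cone. -/
theorem isClosed_reNonneg (L : FunctionLattice l B) : IsClosed {f : B | L.ReNonneg f} := by
  rw [← closure_subset_iff_isClosed]
  intro f hf
  have key : ∀ g, L.ReNonneg g → ‖L.pos (-f)‖ ≤ ‖f - g‖ := by
    intro g hg
    apply L.norm_le_of_rep
    filter_upwards [hg, L.rep_pos (-f), L.rep_neg f, L.rep_sub f g] with x h1 h2 h3 h4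
    rw [h2, h3, h4, Complex.norm_real, Real.norm_eq_abs, abs_of_nonneg (le_max_right _ _)]
    refine max_le ?_ (norm_nonneg _)
    refine le_trans ?_ (Complex.abs_re_le_norm _)
    refine le_trans ?_ (neg_le_abs _)
    simp only [Complex.neg_re, Complex.sub_re]
    linarith
  have h0 : L.pos (-f) = 0 := by
    by_contra hne
    obtain ⟨g, hg, hfg⟩ := Metric.mem_closure_iff.1 hf _ (norm_pos_iff.2 hne)
    rw [dist_eq_norm] at hfg
    exact absurd (key g hg) (not_le.2 hfg)
  have h1 := L.rep_pos (-f)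
  rw [h0] at h1
  change ∀ᶠ x in l, _
  filter_upwards [h1, L.rep_zero, L.rep_neg f] with x h1 h2 h3
  rw [h2, h3, eq_comm, Complex.ofReal_eq_zero, Complex.neg_re] at h1
  have := le_max_left (-(L.rep f x).re) 0
  linarith

theorem isClosed_isNonneg (L : FunctionLattice l B) : IsClosed {f : B | L.IsNonneg f} := by
  simp only [isNonneg_iff_reNonneg, Set.ofPred_and]
  exact L.isClosed_reNonneg.inter
    ((L.isClosed_reNonneg.preimage (continuous_const_smul Complex.I)).inter
      (L.isClosed_reNonneg.preimage (continuous_const_smul (-Complex.I))))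

theorem re_add_I_smul (L : FunctionLattice l B) (f : B) :
    L.re f + Complex.I • L.re (-Complex.I • f) = f := by
  apply L.ext_rep
  filter_upwards [L.rep_add (L.re f) (Complex.I • L.re (-Complex.I • f)), L.rep_re f,
    L.rep_smul Complex.I (L.re (-Complex.I • f)), L.rep_re (-Complex.I • f),
    L.rep_smul (-Complex.I) f] with x h1 h2 h3 h4 h5
  rw [h1, h2, h3, h4, h5]
  apply Complex.ext <;> simp

theorem re_eq_pos_sub (L : FunctionLattice l B) (f : B) : L.re f = L.pos f - L.pos (-f) := by
  apply L.ext_rep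
  filter_upwards [L.rep_re f, L.rep_pos f, L.rep_pos (-f), L.rep_sub (L.pos f) (L.pos (-f)),
    L.rep_neg f] with x h1 h2 h3 h4 h5
  rw [h4, h1, h2, h3, h5, ← Complex.ofReal_sub]
  norm_cast
  rcases le_total 0 (L.rep f x).re with h | h
  · rw [max_eq_left h, max_eq_right (by simpa using h), sub_zero]
  · rw [max_eq_right h, max_eq_left (by simpa using h)]
    simp

/-- The real-valued elements of `B`. -/
def IsReal (L : FunctionLattice l B) (f : B) : Prop := ∀ᶠ x in l, (L.rep f x).im = 0

theorem isReal_re (L : FunctionLattice l B) (f : B) : L.IsReal (L.re f) := by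
  filter_upwards [L.rep_re f] with x hx
  simp [hx]

theorem IsNonneg.isReal {L : FunctionLattice l B} {f : B} (hf : L.IsNonneg f) :
    L.IsReal f := by
  rw [isNonneg_iff] at hf
  exact hf.mono fun x hx => (Complex.nonneg_iff.1 hx).2.symm

theorem IsReal.sub {L : FunctionLattice l B} {f g : B} (hf : L.IsReal f)
    (hg : L.IsReal g) : L.IsReal (f - g) := by
  filter_upwards [hf, hg, L.rep_sub f g] with x h1 h2 h3
  rw [h3, Complex.sub_im, h1, h2, sub_zero]

theorem re_add_I_smul_of_isReal (L : FunctionLattice l B) {f g : B} (hf : L.IsReal f)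
    (hg : L.IsReal g) : L.re (f + Complex.I • g) = f := by
  apply L.ext_rep
  filter_upwards [L.rep_re (f + Complex.I • g), L.rep_add f (Complex.I • g),
    L.rep_smul Complex.I g, hf, hg] with x h1 h2 h3 h4 h5
  rw [h1, h2, h3]
  apply Complex.ext <;> simp [h4, h5]

theorem IsNonnegOperator.isReal_map_re {L : FunctionLattice l B} {Q : B →L[ℂ] B}
    (hQ : L.IsNonnegOperator Q) (f : B) : L.IsReal (Q (L.re f)) := by
  rw [L.re_eq_pos_sub, map_sub]
  exact (hQ _ (L.isNonneg_pos _)).isReal.sub (hQ _ (L.isNonneg_pos _)).isReal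

/-- A nonnegative operator commutes with the real part. -/
theorem IsNonnegOperator.map_re {L : FunctionLattice l B} {Q : B →L[ℂ] B}
    (hQ : L.IsNonnegOperator Q) (f : B) : Q (L.re f) = L.re (Q f) := by
  conv_rhs => rw [← L.re_add_I_smul f, map_add, map_smul]
  rw [L.re_add_I_smul_of_isReal (hQ.isReal_map_re _) (hQ.isReal_map_re _)]

theorem IsNonnegOperator.reNonneg {L : FunctionLattice l B} {Q : B →L[ℂ] B}
    (hQ : L.IsNonnegOperator Q) {f : B} (hf : L.ReNonneg f) : L.ReNonneg (Q f) := by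
  rw [← isNonneg_re_iff, ← hQ.map_re]
  exact hQ _ (L.isNonneg_re_iff.2 hf)

/-- |z| is the supremum of Re(cz) over unit c, and a dense sequence suffices. Countability is what
allows the inequalities to hold simultaneously along a filter closed under countable intersections.
-/
theorem exists_seq_norm_le : ∃ c : ℕ → ℂ, (∀ n, ‖c n‖ = 1) ∧
    ∀ (z : ℂ) (a : ℝ), (∀ n, (c n * z).re ≤ a) → ‖z‖ ≤ a := by
  refine ⟨fun n => (TopologicalSpace.denseSeq Circle n : ℂ), fun n => Circle.norm_coe _, ?_⟩
  intro z a h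
  have h1 : ∀ w : Circle, ((w : ℂ) * z).re ≤ a := by
    have hcl : IsClosed {w : Circle | ((w : ℂ) * z).re ≤ a} :=
      isClosed_le (by fun_prop) continuous_const
    intro w
    exact hcl.closure_subset_iff.2 (by rintro _ ⟨n, rfl⟩; exact h n)
      ((TopologicalSpace.denseRange_denseSeq Circle) w)
  by_cases hz : z = 0
  · simpa [hz] using h 0
  have hn : ‖z‖ ≠ 0 := norm_ne_zero_iff.2 hz
  have hc : ‖(starRingEnd ℂ) z / (‖z‖ : ℂ)‖ = 1 := by
    rw [norm_div, RCLike.norm_conj, Complex.norm_real, norm_norm, div_self hn]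
  have h2 := h1 ⟨(starRingEnd ℂ) z / (‖z‖ : ℂ), mem_sphere_zero_iff_norm.2 hc⟩
  have h3 : (starRingEnd ℂ) z / (‖z‖ : ℂ) * z = (‖z‖ : ℂ) := by
    have : (‖z‖ : ℂ) ≠ 0 := by exact_mod_cast hn
    field_simp
    rw [Complex.conj_mul']
  change ((starRingEnd ℂ) z / (‖z‖ : ℂ) * z).re ≤ a at h2
  rwa [h3, Complex.ofReal_re] at h2

/-- `|Q f| ≤ Q |f|` for a nonnegative operator `Q`. -/
theorem IsNonnegOperator.norm_rep_le [CountableInterFilter l] {L : FunctionLattice l B}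
    {Q : B →L[ℂ] B} (hQ : L.IsNonnegOperator Q) (f : B) :
    ∀ᶠ x in l, ‖L.rep (Q f) x‖ ≤ (L.rep (Q (L.abs f)) x).re := by
  obtain ⟨c, hc, H⟩ := exists_seq_norm_le
  have h : ∀ n, ∀ᶠ x in l, (c n * L.rep (Q f) x).re ≤ (L.rep (Q (L.abs f)) x).re := by
    intro n
    have h1 : L.ReNonneg (L.abs f - c n • f) := by
      filter_upwards [L.rep_sub (L.abs f) (c n • f), L.rep_abs f, L.rep_smul (c n) f]
        with x h1 h2 h3
      rw [h1, h2, h3, Complex.sub_re, Complex.ofReal_re, sub_nonneg]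
      refine (Complex.re_le_norm _).trans ?_
      rw [norm_mul, hc, one_mul]
    have h2 := hQ.reNonneg h1
    rw [map_sub, map_smul] at h2
    filter_upwards [h2, L.rep_sub (Q (L.abs f)) (c n • Q f), L.rep_smul (c n) (Q f)]
      with x h1 h2 h3
    rw [h2, h3, Complex.sub_re, sub_nonneg] at h1
    exact h1
  filter_upwards [eventually_countable_forall.2 h] with x hx
  exact H _ _ hx

/-- A nonnull nonnegative element is not annihilated by all nonnegative linear forms. -/
theorem exists_isNonnegDual_pos (L : FunctionLattice l B) {φ : B} (hφ : L.IsNonneg φ)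
    (h0 : φ ≠ 0) : ∃ ψ : B →L[ℂ] ℂ, L.IsNonnegDual ψ ∧ 0 < ψ φ := by
  let _ : NormedSpace ℝ B := NormedSpace.restrictScalars ℝ ℂ B
  have hsm : ∀ (c : ℝ) (f : B), c • f = (c : ℂ) • f := fun c f => rfl
  have hconv : Convex ℝ {f : B | L.ReNonneg f} := by
    intro f hf g hg a b ha hb _
    rw [hsm, hsm]
    exact (ReNonneg.smul hf ha).add (ReNonneg.smul hg hb)
  have hmem : -φ ∉ {f : B | L.ReNonneg f} := by
    intro h
    apply h0
    rw [isNonneg_iff] at hφ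
    apply L.eq_zero_of_rep
    filter_upwards [h, hφ, L.rep_neg φ] with x h1 h2 h3
    rw [h3, Complex.neg_re] at h1
    obtain ⟨h4, h5⟩ := Complex.nonneg_iff.1 h2
    exact Complex.ext (by rw [Complex.zero_re]; linarith) h5.symm
  -- Hahn–Banach: -φ is strictly separated from the closed convex cone.
  obtain ⟨ψ, u, hu, hψ⟩ :=
    RCLike.geometric_hahn_banach_point_closed (𝕜 := ℂ) hconv L.isClosed_reNonneg hmem
  have hu0 : u < 0 := by
    have := hψ 0 L.isNonneg_zero.reNonneg
    simpa using this
  have hre : ∀ f, L.ReNonneg f → 0 ≤ (ψ f).re := by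
    intro f hf
    by_contra hneg
    push Not at hneg
    -- A negative value could be scaled inside the cone to equal `u`, against strict separation.
    have hpos : 0 ≤ u / (ψ f).re := div_nonneg_of_nonpos hu0.le hneg.le
    have h1 := hψ _ (ReNonneg.smul hf hpos)
    rw [map_smul, smul_eq_mul, RCLike.re_to_complex, Complex.re_ofReal_mul,
      div_mul_cancel₀ _ hneg.ne] at h1
    exact lt_irrefl _ h1
  have hnn : L.IsNonnegDual ψ := by
    intro f hf
    obtain ⟨h1, h2, h3⟩ := L.isNonneg_iff_reNonneg.1 hf
    have h2 := hre _ h2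
    have h3 := hre _ h3
    rw [map_smul] at h2 h3
    simp at h2 h3
    exact Complex.nonneg_iff.2 ⟨hre f h1, le_antisymm h3 h2⟩
  refine ⟨ψ, hnn, lt_of_le_of_ne (hnn φ hφ) fun h => ?_⟩
  rw [map_neg, ← h] at hu
  simp at hu
  linarith

theorem IsNonnegDual.im_eq_zero {L : FunctionLattice l B} {ψ : B →L[ℂ] ℂ}
    (hψ : L.IsNonnegDual ψ) (f : B) : (ψ (L.re f)).im = 0 := by
  rw [L.re_eq_pos_sub, map_sub, Complex.sub_im,
    ← (Complex.nonneg_iff.1 (hψ _ (L.isNonneg_pos f))).2,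
    ← (Complex.nonneg_iff.1 (hψ _ (L.isNonneg_pos (-f)))).2, sub_zero]

end FunctionLattice

/-! ### Quasi-compactness: cluster points of approximate eigenvectors and eigenforms. -/

section QuasiCompact

open Topology

variable {B : Type*} [NormedAddCommGroup B] [NormedSpace ℂ B]

theorem spectralRadius_eq_ofReal_specRadius [CompleteSpace B] (Q : B →L[ℂ] B) :
    spectralRadius ℂ Q = ENNReal.ofReal (specRadius Q) := by
  have : spectralRadius ℂ Q ≠ ∞ := by
    -- The factor ‖1‖ is kept because B may be zero here.
    refine ne_top_of_le_ne_top ?_ (iSup₂_le fun k hk => ?_ :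
      spectralRadius ℂ Q ≤ ENNReal.ofReal (‖Q‖ * ‖(1 : B →L[ℂ] B)‖))
    · exact ENNReal.ofReal_ne_top
    · have := spectrum.norm_le_norm_mul_of_mem hk
      rw [← enorm_eq_nnnorm, ← ofReal_norm]
      exact ENNReal.ofReal_le_ofReal this
  rw [specRadius, ENNReal.ofReal_toReal this]

/-- A power of a quasi-compact operator is a compact perturbation of an operator of norm less than
the corresponding power of the spectral radius. -/
theorem IsQuasiCompact.exists_pow_sub_lt [CompleteSpace B] {Q : B →L[ℂ] B}
    (hQ : IsQuasiCompact Q) :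
    ∃ (m : ℕ) (F : B →L[ℂ] B), IsCompactOperator F ∧ ‖Q ^ m - F‖ < specRadius Q ^ m := by
  have h := eventually_lt_of_limsup_lt hQ
  obtain ⟨m, hm, hm0⟩ := (h.and (eventually_gt_atTop 0)).exists
  have hm' : (0 : ℝ) < m := by exact_mod_cast hm0
  have h1 := ENNReal.rpow_lt_rpow hm hm'
  rw [← ENNReal.rpow_mul, one_div_mul_cancel hm'.ne', ENNReal.rpow_one, ENNReal.rpow_natCast,
    iInf_lt_iff] at h1
  obtain ⟨⟨F, hF⟩, h2⟩ := h1
  refine ⟨m, F, hF, ?_⟩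
  have h0 : 0 ≤ specRadius Q := ENNReal.toReal_nonneg
  rw [spectralRadius_eq_ofReal_specRadius, ← ENNReal.ofReal_pow h0, ← ofReal_norm] at h2
  exact (ENNReal.ofReal_lt_ofReal_iff_of_nonneg (norm_nonneg _)).1 h2

/-- Approximate eigenvectors of a quasi-compact operator subconverge to an eigenvector. -/
theorem exists_tendsto_of_approx_eigenvector [CompleteSpace B] {Q F : B →L[ℂ] B} {m : ℕ} {r : ℂ}
    (hF : IsCompactOperator F) (hS : ‖Q ^ m - F‖ < ‖r ^ m‖) {t : ℕ → ℂ}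
    (ht : Tendsto t atTop (𝓝 r)) {x : ℕ → B} (hx : ∀ n, ‖x n‖ = 1)
    (h : Tendsto (fun n => t n • x n - Q (x n)) atTop (𝓝 0)) :
    ∃ (y : B) (σ : ℕ → ℕ), StrictMono σ ∧ Tendsto (x ∘ σ) atTop (𝓝 y) ∧ y ≠ 0 ∧ Q y = r • y := by
  obtain ⟨K, hK, hKF⟩ := hF.image_closedBall_subset_compact (f := (F : B →ₗ[ℂ] B)) 1
  obtain ⟨z, -, σ, hσ, hz⟩ := hK.tendsto_subseq (x := fun n => F (x n))
    fun n => hKF ⟨x n, by simp [hx n], rfl⟩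
  have h1 : Tendsto (fun n => r • x n - Q (x n)) atTop (𝓝 0) := by
    have h2 : Tendsto (fun n => (r - t n) • x n) atTop (𝓝 0) := by
      rw [tendsto_zero_iff_norm_tendsto_zero]
      simp only [norm_smul, hx, mul_one]
      rw [← tendsto_zero_iff_norm_tendsto_zero]
      simpa using (tendsto_const_nhds (x := r)).sub ht
    have h3 := h2.add h
    rw [add_zero] at h3
    refine h3.congr fun n => ?_
    rw [sub_smul]; abel
  have hcomm : Commute (algebraMap ℂ (B →L[ℂ] B) r) Q := Algebra.commutes r Q
  -- r^m - Q^m = G (r - Q) with G the geometric sum, so the approximation passes to the m-th power,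
  -- where the compact operator is available.
  have h2 : Tendsto (fun n => r ^ m • x n - (Q ^ m) (x n)) atTop (𝓝 0) := by
    have h3 := ((∑ i ∈ Finset.range m, (algebraMap ℂ (B →L[ℂ] B) r) ^ i * Q ^ (m - 1 - i)).continuous.tendsto 0).comp h1
    rw [map_zero] at h3
    refine h3.congr fun n => ?_
    have h4 := congrArg (fun T : B →L[ℂ] B => T (x n)) (hcomm.geom_sum₂_mul m)
    have h5 : (algebraMap ℂ (B →L[ℂ] B) r - Q) (x n) = r • x n - Q (x n) := by
      simp [Algebra.algebraMap_eq_smul_one]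
    simp only [mul_apply_eq_comp, h5] at h4
    rw [Function.comp_apply, h4, ← map_pow]
    simp [Algebra.algebraMap_eq_smul_one]
  by_cases hB : Subsingleton B
  · have := hx 0
    rw [Subsingleton.elim (x 0) 0, norm_zero] at this
    norm_num at this
  have : Nontrivial B := not_subsingleton_iff_nontrivial.1 hB
  -- r^m - (Q^m - F) is invertible and maps x_n to (r^m - Q^m)x_n + F x_n, which converges along σ;
  -- applying the inverse makes x_n itself converge.
  obtain ⟨U, hU⟩ : IsUnit (algebraMap ℂ (B →L[ℂ] B) (r ^ m) - (Q ^ m - F)) :=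
    spectrum.mem_resolventSet_of_norm_lt hS
  have h3 : Tendsto (fun n => (U : B →L[ℂ] B) (x (σ n))) atTop (𝓝 z) := by
    have h4 := (h2.comp hσ.tendsto_atTop).add hz
    rw [zero_add] at h4
    refine h4.congr fun n => ?_
    rw [hU]
    simp [Algebra.algebraMap_eq_smul_one]
    abel
  have h4 : Tendsto (x ∘ σ) atTop (𝓝 ((↑U⁻¹ : B →L[ℂ] B) z)) := by
    refine (((↑U⁻¹ : B →L[ℂ] B).continuous.tendsto z).comp h3).congr fun n => ?_
    rw [Function.comp_apply, ← mul_apply_eq_comp, Units.inv_mul]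
    rfl
  refine ⟨_, σ, hσ, h4, ?_, ?_⟩
  · have h5 := h4.norm
    simp only [Function.comp_apply, hx] at h5
    have := tendsto_nhds_unique h5 tendsto_const_nhds
    rw [← norm_pos_iff, this]
    exact one_pos
  · have h5 := (h4.const_smul r).sub ((Q.continuous.tendsto _).comp h4)
    have h6 := tendsto_nhds_unique h5 (h1.comp hσ.tendsto_atTop)
    exact (sub_eq_zero.1 h6).symm

/-- Approximate eigenforms of a quasi-compact operator have a nonzero cluster point. -/
theorem exists_eigenform_of_approx [CompleteSpace B] {Q F : B →L[ℂ] B} {m : ℕ} {r : ℂ}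
    (hF : IsCompactOperator F) (hS : ‖Q ^ m - F‖ < ‖r ^ m‖) {t : ℕ → ℂ}
    (ht : Tendsto t atTop (𝓝 r)) {ψ : ℕ → B →L[ℂ] ℂ} (hψ : ∀ n, ‖ψ n‖ = 1)
    (h : Tendsto (fun n => t n • ψ n - (ψ n).comp Q) atTop (𝓝 0)) :
    ∃ (p : B →L[ℂ] ℂ) (U : Ultrafilter ℕ), (∀ f, Tendsto (fun n => ψ n f) U (𝓝 (p f))) ∧
      p ≠ 0 ∧ p.comp Q = r • p := by
  let U : Ultrafilter ℕ := Ultrafilter.of atTop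
  have hU : (U : Filter ℕ) ≤ atTop := Ultrafilter.of_le atTop
  -- Banach–Alaoglu by hand: each bounded sequence of values converges along the ultrafilter, and
  -- the limits form a bounded linear form.
  have hlim : ∀ f : B, ∃ w : ℂ, Tendsto (fun n => ψ n f) U (𝓝 w) ∧ ‖w‖ ≤ ‖f‖ := by
    intro f
    have hc := isCompact_closedBall (0 : ℂ) ‖f‖
    obtain ⟨w, hw, hw'⟩ := hc.ultrafilter_le_nhds (U.map fun n => ψ n f) (by
      rw [Ultrafilter.coe_map, le_principal_iff, mem_map]
      refine univ_mem' fun n => ?_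
      simpa [hψ n] using (ψ n).le_opNorm f)
    exact ⟨w, hw', by simpa using hw⟩
  choose p hp hpn using hlim
  let P : B →L[ℂ] ℂ := LinearMap.mkContinuous
    { toFun := p
      map_add' := fun f g => tendsto_nhds_unique (hp (f + g)) (by
        simpa using (hp f).add (hp g))
      map_smul' := fun c f => tendsto_nhds_unique (hp (c • f)) (by
        simpa using (hp f).const_mul c) } 1 (fun f => by simpa using hpn f)
  have hP : ∀ f, Tendsto (fun n => ψ n f) U (𝓝 (P f)) := hp
  have h1 : Tendsto (fun n => r • ψ n - (ψ n).comp Q) atTop (𝓝 0) := by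
    have h2 : Tendsto (fun n => (r - t n) • ψ n) atTop (𝓝 0) := by
      rw [tendsto_zero_iff_norm_tendsto_zero]
      simp only [norm_smul, hψ, mul_one]
      rw [← tendsto_zero_iff_norm_tendsto_zero]
      simpa using (tendsto_const_nhds (x := r)).sub ht
    have h3 := h2.add h
    rw [add_zero] at h3
    refine h3.congr fun n => ?_
    ext f
    simp [sub_mul]
  refine ⟨P, U, hP, ?_, ?_⟩
  swap
  · ext f
    have h2 : Tendsto (fun n => (r • ψ n - (ψ n).comp Q) f) U (𝓝 0) :=
      (((ContinuousLinearMap.apply ℂ ℂ f).continuous.tendsto 0).comp h1).mono_left hU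
    have h3 : Tendsto (fun n => (r • ψ n - (ψ n).comp Q) f) U (𝓝 (r * P f - P (Q f))) := by
      simpa using ((hP f).const_mul r).sub (hP (Q f))
    have := tendsto_nhds_unique h3 h2
    simpa using (sub_eq_zero.1 this).symm
  -- A weak-* limit of unit forms may vanish; compactness of F excludes it. The norms of ψ_n ∘ F
  -- stay bounded below, while a zero limit would force ψ_n(F x_n) → 0 along U, because F x_n
  -- converges in norm.
  intro hP0
  have hcomm : Commute (algebraMap ℂ (B →L[ℂ] B) r) Q := Algebra.commutes r Q
  have h2 : Tendsto (fun n => r ^ m • ψ n - (ψ n).comp (Q ^ m)) atTop (𝓝 0) := by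
    set G := ∑ i ∈ Finset.range m, (algebraMap ℂ (B →L[ℂ] B) r) ^ i * Q ^ (m - 1 - i) with hG
    have h3 := (((ContinuousLinearMap.compL ℂ B B ℂ).flip G).continuous.tendsto 0).comp h1
    rw [map_zero] at h3
    refine h3.congr fun n => ?_
    ext f
    have h4 := congrArg (fun T : B →L[ℂ] B => ψ n (T f)) (hcomm.mul_geom_sum₂ m)
    rw [← hG] at h4
    simp only [mul_apply_eq_comp, ← map_pow] at h4
    simpa [Algebra.algebraMap_eq_smul_one] using h4
  set S := Q ^ m - F with hSdef
  have h3 : ∃ δ > 0, ∀ᶠ n in atTop, δ < ‖(ψ n).comp F‖ := by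
    refine ⟨(‖r ^ m‖ - ‖S‖) / 2, by linarith, ?_⟩
    have h4 : ∀ᶠ n in atTop, ‖r ^ m • ψ n - (ψ n).comp (Q ^ m)‖ < (‖r ^ m‖ - ‖S‖) / 2 := by
      refine (tendsto_zero_iff_norm_tendsto_zero.1 h2).eventually_lt_const ?_
      linarith
    filter_upwards [h4] with n hn
    have h5 : r ^ m • ψ n = (r ^ m • ψ n - (ψ n).comp (Q ^ m)) + (ψ n).comp S + (ψ n).comp F := by
      ext f
      simp [hSdef]
    have h6 : ‖r ^ m‖ = ‖r ^ m • ψ n‖ := by rw [norm_smul, hψ, mul_one]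
    have h7 : ‖(ψ n).comp S‖ ≤ ‖S‖ := by
      simpa [hψ n] using (ψ n).opNorm_comp_le S
    have h8 := norm_add₃_le (a := r ^ m • ψ n - (ψ n).comp (Q ^ m)) (b := (ψ n).comp S)
      (c := (ψ n).comp F)
    rw [← h5, ← h6] at h8
    linarith
  obtain ⟨δ, hδ, h3⟩ := h3
  -- x_n almost attains the norm of ψ_n ∘ F; the value 0 is only a default for the finitely many bad
  -- n.
  have h4 : ∀ n, ∃ x : B, ‖x‖ ≤ 1 ∧ (δ < ‖(ψ n).comp F‖ → δ < ‖ψ n (F x)‖) := by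
    intro n
    by_cases hn : δ < ‖(ψ n).comp F‖
    · obtain ⟨x, hx, hx'⟩ := ((ψ n).comp F).exists_lt_apply_of_lt_opNorm hn
      exact ⟨x, hx.le, fun _ => hx'⟩
    · exact ⟨0, by simp, fun h => absurd h hn⟩
  choose x hx hx' using h4
  obtain ⟨K, hK, hKF⟩ := hF.image_closedBall_subset_compact (f := (F : B →ₗ[ℂ] B)) 1
  obtain ⟨y, -, hy⟩ := hK.ultrafilter_le_nhds (U.map fun n => F (x n)) (by
    rw [Ultrafilter.coe_map, le_principal_iff, mem_map]
    exact univ_mem' fun n => hKF ⟨x n, by simpa using hx n, rfl⟩)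
  have hy : Tendsto (fun n => F (x n)) U (𝓝 y) := hy
  have h5 : Tendsto (fun n => ψ n (F (x n))) U (𝓝 0) := by
    have h6 : Tendsto (fun n => ψ n (F (x n) - y)) U (𝓝 0) := by
      have h7 : Tendsto (fun n => F (x n) - y) U (𝓝 0) := by
        simpa using hy.sub_const y
      refine squeeze_zero_norm (fun n => ?_) (tendsto_zero_iff_norm_tendsto_zero.1 h7)
      simpa [hψ n] using (ψ n).le_opNorm (F (x n) - y)
    have h8 := h6.add (hP y)
    rw [hP0] at h8
    simpa using h8
  have h6 : ∀ᶠ n in (U : Filter ℕ), ‖ψ n (F (x n))‖ < δ :=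
    (tendsto_zero_iff_norm_tendsto_zero.1 h5).eventually_lt_const hδ
  obtain ⟨n, hn, hn'⟩ := (h6.and (hU h3)).exists
  exact absurd (hx' n hn') (not_lt.2 hn.le)

/-- Otherwise z - Q = (w - Q)(1 - (w - z)R(w)) would be a product of units. This is the source of
every blow-up of the resolvent below. -/
theorem one_le_dist_mul_norm_resolvent [CompleteSpace B] {Q : B →L[ℂ] B} {z w : ℂ}
    (hz : z ∈ spectrum ℂ Q) (hw : w ∈ resolventSet ℂ Q) : 1 ≤ ‖z - w‖ * ‖resolvent Q w‖ := by
  by_contra! h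
  apply hz
  change IsUnit (algebraMap ℂ (B →L[ℂ] B) z - Q)
  have h1 : algebraMap ℂ (B →L[ℂ] B) z - Q =
      (algebraMap ℂ (B →L[ℂ] B) w - Q) * (1 - (w - z) • resolvent Q w) := by
    rw [mul_sub, mul_smul_comm, resolvent, Ring.mul_inverse_cancel _ hw, mul_one,
      Algebra.algebraMap_eq_smul_one, Algebra.algebraMap_eq_smul_one, sub_smul]
    abel
  rw [h1]
  refine IsUnit.mul hw (isUnit_one_sub_of_norm_lt_one ?_)
  rwa [norm_smul, norm_sub_rev]

end QuasiCompact

/-! ### The resolvent outside the spectral disc. -/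

section NeumannSeries

open Topology

variable {B : Type*} [NormedAddCommGroup B] [NormedSpace ℂ B]

theorem mem_resolventSet_of_specRadius_lt [CompleteSpace B] {Q : B →L[ℂ] B} {z : ℂ} (hz : specRadius Q < ‖z‖) :
    z ∈ resolventSet ℂ Q := by
  apply spectrum.mem_resolventSet_of_spectralRadius_lt
  rw [spectralRadius_eq_ofReal_specRadius, ← enorm_eq_nnnorm, ← ofReal_norm]
  exact (ENNReal.ofReal_lt_ofReal_iff_of_nonneg ENNReal.toReal_nonneg).2 hz

theorem resolvent_sub_mul {Q : B →L[ℂ] B} {z : ℂ} (hz : z ∈ resolventSet ℂ Q) (f : B) :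
    z • resolvent Q z f - Q (resolvent Q z f) = f := by
  have h := congrArg (fun T : B →L[ℂ] B => T f) (Ring.mul_inverse_cancel _ hz)
  simpa [resolvent, Algebra.algebraMap_eq_smul_one] using h

theorem resolvent_mul_sub {Q : B →L[ℂ] B} {z : ℂ} (hz : z ∈ resolventSet ℂ Q) (f : B) :
    z • resolvent Q z f - resolvent Q z (Q f) = f := by
  have h := congrArg (fun T : B →L[ℂ] B => T f) (Ring.inverse_mul_cancel _ hz)
  simpa [resolvent, Algebra.algebraMap_eq_smul_one] using h

/-- The Neumann series of the resolvent converges outside the spectral disc. -/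
theorem hasSum_resolvent [CompleteSpace B] {Q : B →L[ℂ] B} {z : ℂ} (hz : specRadius Q < ‖z‖) :
    HasSum (fun n : ℕ => z⁻¹ ^ (n + 1) • Q ^ n) (resolvent Q z) := by
  have h0 : 0 ≤ specRadius Q := ENNReal.toReal_nonneg
  have hz0 : z ≠ 0 := norm_pos_iff.1 (h0.trans_lt hz)
  obtain ⟨ρ, hρ, hρz⟩ := exists_between hz
  have hρ0 : 0 < ρ := h0.trans_lt hρ
  -- Gelfand's formula, with ρ strictly between the spectral radius and |z|.
  have h1 : ∀ᶠ n : ℕ in atTop, ‖(z⁻¹ • Q) ^ n‖ ≤ (ρ / ‖z‖) ^ n := by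
    have h2 := (spectrum.pow_norm_pow_one_div_tendsto_nhds_spectralRadius Q).eventually_lt_const
      (u := ENNReal.ofReal ρ) (by
        rw [spectralRadius_eq_ofReal_specRadius]
        exact (ENNReal.ofReal_lt_ofReal_iff_of_nonneg h0).2 hρ)
    filter_upwards [h2, eventually_gt_atTop 0] with n hn hn0
    have h3 := (ENNReal.ofReal_lt_ofReal_iff hρ0).1 hn
    have h4 : ‖Q ^ n‖ ≤ ρ ^ n := by
      have h5 := pow_le_pow_left₀ (by positivity) h3.le n
      rwa [one_div, Real.rpow_inv_natCast_pow (norm_nonneg _) hn0.ne'] at h5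
    rw [smul_pow, norm_smul, norm_pow, norm_inv, div_pow, inv_pow, div_eq_inv_mul]
    gcongr
  have hs : Summable fun n : ℕ => (z⁻¹ • Q) ^ n := by
    refine Summable.of_norm_bounded_eventually_nat
      (summable_geometric_of_lt_one (by positivity) ((div_lt_one (h0.trans_lt hz)).2 hρz)) h1
  have h2 := hs.tsum_pow_mul_one_sub
  have h3 : resolvent Q z = z⁻¹ • ∑' n : ℕ, (z⁻¹ • Q) ^ n := by
    rw [resolvent, ← one_mul (Ring.inverse _), eq_comm,
      Ring.eq_mul_inverse_iff_mul_eq _ _ _ (mem_resolventSet_of_specRadius_lt hz)]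
    have h4 : algebraMap ℂ (B →L[ℂ] B) z - Q = z • (1 - z⁻¹ • Q) := by
      rw [smul_sub, smul_smul, mul_inv_cancel₀ hz0, one_smul, Algebra.algebraMap_eq_smul_one]
    rw [h4, smul_mul_assoc, mul_smul_comm, smul_smul, inv_mul_cancel₀ hz0, one_smul, h2]
  rw [h3]
  refine (hs.hasSum.const_smul z⁻¹).congr_fun fun n => ?_
  rw [smul_pow, smul_smul, pow_succ']

end NeumannSeries

/-! ### Krein–Rutman: nonnegative eigenvector and eigenform for the spectral radius. -/

namespace FunctionLattice

open Topology

variable {X : Type*} {l : Filter X} {B : Type*} [NormedAddCommGroup B] [NormedSpace ℂ B]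

theorem IsNonnegOperator.pow {L : FunctionLattice l B} {Q : B →L[ℂ] B}
    (hQ : L.IsNonnegOperator Q) (n : ℕ) : L.IsNonnegOperator (Q ^ n) := by
  induction n with
  | zero => intro f hf; simpa using hf
  | succ n ih =>
    intro f hf
    rw [pow_succ]
    exact ih _ (hQ _ hf)

variable [CompleteSpace B]

/-- The resolvent of a nonnegative operator is nonnegative to the right of the spectral radius. -/
theorem IsNonnegOperator.resolvent_nonneg {L : FunctionLattice l B} {Q : B →L[ℂ] B}
    (hQ : L.IsNonnegOperator Q) {t : ℝ} (ht : specRadius Q < t) :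
    L.IsNonnegOperator (resolvent Q (t : ℂ)) := by
  intro f hf
  have h0 : 0 ≤ specRadius Q := ENNReal.toReal_nonneg
  have ht0 : 0 < t := h0.trans_lt ht
  have h1 := ((hasSum_resolvent (Q := Q) (z := (t : ℂ)) (by
    rwa [Complex.norm_real, Real.norm_of_nonneg ht0.le])).mapL
      (ContinuousLinearMap.apply ℂ B f)).tendsto_sum_nat
  refine L.isClosed_isNonneg.mem_of_tendsto h1 (Eventually.of_forall fun N => ?_)
  change L.IsNonneg _
  induction N with
  | zero => simpa using L.isNonneg_zero
  | succ N ih =>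
    rw [Finset.sum_range_succ]
    refine ih.add ?_
    have h2 := (hQ.pow N f hf).smul (c := t⁻¹ ^ (N + 1)) (by positivity)
    simpa using h2

/-- Termwise domination of the Neumann series. This transfers blow-up of the resolvent from an
arbitrary point of the spectral circle to the positive real point of that circle. -/
theorem IsNonnegOperator.norm_resolvent_le [CountableInterFilter l] {L : FunctionLattice l B}
    {Q : B →L[ℂ] B} (hQ : L.IsNonnegOperator Q) {z : ℂ} (hz : specRadius Q < ‖z‖) (f : B) :
    ‖resolvent Q z f‖ ≤ ‖resolvent Q ((‖z‖ : ℝ) : ℂ) (L.abs f)‖ := by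
  have h1 := ((hasSum_resolvent (Q := Q) hz).mapL
      (ContinuousLinearMap.apply ℂ B f)).tendsto_sum_nat
  have h2 := ((hasSum_resolvent (Q := Q) (z := ((‖z‖ : ℝ) : ℂ)) (by simpa using hz)).mapL
      (ContinuousLinearMap.apply ℂ B (L.abs f))).tendsto_sum_nat
  refine le_of_tendsto_of_tendsto' h1.norm h2.norm fun N => ?_
  apply L.norm_le_of_rep
  -- Partial sums are compared with a real part, which is additive, so that the induction closes.
  suffices h : ∀ᶠ x in l, ‖L.rep (∑ n ∈ Finset.range N, z⁻¹ ^ (n + 1) • (Q ^ n) f) x‖ ≤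
      (L.rep (∑ n ∈ Finset.range N, ((‖z‖ : ℝ) : ℂ)⁻¹ ^ (n + 1) • (Q ^ n) (L.abs f)) x).re by
    filter_upwards [h] with x hx
    exact hx.trans (Complex.re_le_norm _)
  induction N with
  | zero =>
    filter_upwards [L.rep_zero] with x hx
    simp [hx]
  | succ N ih =>
    rw [Finset.sum_range_succ, Finset.sum_range_succ]
    filter_upwards [ih, L.rep_add (∑ n ∈ Finset.range N, z⁻¹ ^ (n + 1) • (Q ^ n) f)
        (z⁻¹ ^ (N + 1) • (Q ^ N) f),
      L.rep_add (∑ n ∈ Finset.range N, ((‖z‖ : ℝ) : ℂ)⁻¹ ^ (n + 1) • (Q ^ n) (L.abs f))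
        (((‖z‖ : ℝ) : ℂ)⁻¹ ^ (N + 1) • (Q ^ N) (L.abs f)),
      L.rep_smul (z⁻¹ ^ (N + 1)) ((Q ^ N) f),
      L.rep_smul (((‖z‖ : ℝ) : ℂ)⁻¹ ^ (N + 1)) ((Q ^ N) (L.abs f)),
      (hQ.pow N).norm_rep_le f] with x h1 h2 h3 h4 h5 h6
    rw [h2, h3, h4, h5, Complex.add_re]
    refine (norm_add_le _ _).trans (add_le_add h1 ?_)
    rw [norm_mul, norm_pow, norm_inv, ← Complex.ofReal_inv, ← Complex.ofReal_pow,
      Complex.re_ofReal_mul]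
    gcongr

/-- The spectral radius of a nonnegative quasi-compact operator is an eigenvalue with a nonnegative
eigenvector. -/
theorem IsNonnegOperator.exists_eigenvector [Nontrivial B] [CountableInterFilter l] {L : FunctionLattice l B}
    {Q : B →L[ℂ] B} (hQ : L.IsNonnegOperator Q) (hqc : IsQuasiCompact Q)
    (hr : 0 < specRadius Q) :
    ∃ φ : B, L.IsNonneg φ ∧ φ ≠ 0 ∧ Q φ = (specRadius Q : ℂ) • φ := by
  obtain ⟨m, F, hF, hS⟩ := hqc.exists_pow_sub_lt
  obtain ⟨z₀, hz₀, hzr⟩ := spectrum.exists_nnnorm_eq_spectralRadius Q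
  set r := specRadius Q with hrdef
  have hz₀r : ‖z₀‖ = r := by rw [hrdef, specRadius, ← hzr]; rfl
  have hs0 : ∀ k : ℕ, (0 : ℝ) < 1 + 1 / ((k : ℝ) + 1) := fun k => by positivity
  -- z_k tends radially to the spectral value z₀ of maximal modulus, and t_k = |z_k| decreases to r.
  set z : ℕ → ℂ := fun k => ((1 + 1 / ((k : ℝ) + 1) : ℝ) : ℂ) * z₀ with hz
  set t : ℕ → ℝ := fun k => (1 + 1 / ((k : ℝ) + 1)) * r with ht
  have hzt : ∀ k, ‖z k‖ = t k := fun k => by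
    rw [hz, norm_mul, Complex.norm_real, Real.norm_of_nonneg (hs0 k).le, hz₀r]
  have hrt : ∀ k, r < t k := fun k => by
    have : 0 < 1 / ((k : ℝ) + 1) * r := by positivity
    simp only [ht]; linarith
  have hdist : ∀ k, ‖z₀ - z k‖ = r / ((k : ℝ) + 1) := fun k => by
    have : z₀ - z k = -(((1 / ((k : ℝ) + 1) : ℝ) : ℂ) * z₀) := by
      simp only [hz]; push_cast; ring
    rw [this, norm_neg, norm_mul, Complex.norm_real, Real.norm_of_nonneg (by positivity), hz₀r]
    ring
  -- The resolvent at z_k has norm at least (k + 1)/r; halving this leaves room for a vector in the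
  -- unit ball, whose modulus is g_k.
  have hg : ∀ k : ℕ, ∃ g : B, L.IsNonneg g ∧ ‖g‖ ≤ 1 ∧
      ((k : ℝ) + 1) / (2 * r) < ‖resolvent Q (t k : ℂ) g‖ := by
    intro k
    have h1 : r < ‖z k‖ := by rw [hzt]; exact hrt k
    have h2 := one_le_dist_mul_norm_resolvent hz₀ (mem_resolventSet_of_specRadius_lt h1)
    rw [hdist, div_mul_eq_mul_div, le_div_iff₀ (by positivity), one_mul] at h2
    have h3 : ((k : ℝ) + 1) / (2 * r) < ‖resolvent Q (z k)‖ := by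
      rw [div_lt_iff₀ (by positivity)]
      have : (0 : ℝ) < k + 1 := by positivity
      linarith
    obtain ⟨f, hf, hf'⟩ := ContinuousLinearMap.exists_lt_apply_of_lt_opNorm _ h3
    refine ⟨L.abs f, L.isNonneg_abs f, by rw [L.norm_abs]; exact hf.le, ?_⟩
    rw [← hzt]
    exact hf'.trans_le (hQ.norm_resolvent_le h1 f)
  choose g hg0 hg1 hg2 using hg
  set y : ℕ → B := fun k => resolvent Q (t k : ℂ) (g k) with hy
  have hypos : ∀ k, 0 < ‖y k‖ := fun k => lt_of_le_of_lt (by positivity) (hg2 k)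
  set x : ℕ → B := fun k => ((‖y k‖⁻¹ : ℝ) : ℂ) • y k with hx
  have hx1 : ∀ k, ‖x k‖ = 1 := fun k => by
    rw [hx, norm_smul, Complex.norm_real, Real.norm_of_nonneg (by positivity),
      inv_mul_cancel₀ (hypos k).ne']
  have hxnn : ∀ k, L.IsNonneg (x k) := fun k =>
    IsNonneg.smul (hQ.resolvent_nonneg (hrt k) _ (hg0 k)) (by positivity)
  have htlim : Tendsto (fun k => (t k : ℂ)) atTop (𝓝 (r : ℂ)) := by
    have h1 : Tendsto t atTop (𝓝 ((1 + 0) * r)) :=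
      (tendsto_const_nhds.add tendsto_one_div_add_atTop_nhds_zero_nat).mul_const r
    rw [add_zero, one_mul] at h1
    exact (Complex.continuous_ofReal.tendsto r).comp h1
  have happ : Tendsto (fun k => (t k : ℂ) • x k - Q (x k)) atTop (𝓝 0) := by
    have h1 : Tendsto (fun k : ℕ => 2 * r * (1 / ((k : ℝ) + 1))) atTop (𝓝 0) := by
      simpa using (tendsto_one_div_add_atTop_nhds_zero_nat (𝕜 := ℝ)).const_mul (2 * r)
    refine squeeze_zero_norm (fun k => ?_) h1
    have h2 : (t k : ℂ) • x k - Q (x k) = ((‖y k‖⁻¹ : ℝ) : ℂ) • g k := by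
      have h3 := resolvent_sub_mul (Q := Q) (z := (t k : ℂ)) (mem_resolventSet_of_specRadius_lt (by
        rw [Complex.norm_real, Real.norm_of_nonneg (hr.trans (hrt k)).le]; exact hrt k)) (g k)
      simp only [hx, map_smul]
      rw [smul_comm, ← smul_sub, h3]
    rw [h2, norm_smul, Complex.norm_real, Real.norm_of_nonneg (by positivity)]
    calc ‖y k‖⁻¹ * ‖g k‖ ≤ (((k : ℝ) + 1) / (2 * r))⁻¹ * 1 := by
          gcongr
          · exact (hg2 k).le
          · exact hg1 k
      _ = 2 * r * (1 / ((k : ℝ) + 1)) := by rw [mul_one, inv_div]; ring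
  obtain ⟨φ, σ, -, hσ, hφ0, hφ⟩ := exists_tendsto_of_approx_eigenvector (r := (r : ℂ)) hF (by
    rw [norm_pow, Complex.norm_real, Real.norm_of_nonneg hr.le]; exact hS) htlim hx1 happ
  exact ⟨φ, L.isClosed_isNonneg.mem_of_tendsto hσ (Eventually.of_forall fun k => hxnn _), hφ0, hφ⟩

/-- A nonnegative quasi-compact operator with a nonnegative eigenvector for its spectral radius has
a nonnegative eigenform. -/
theorem IsNonnegOperator.exists_eigenform {L : FunctionLattice l B}
    {Q : B →L[ℂ] B} (hQ : L.IsNonnegOperator Q) (hqc : IsQuasiCompact Q)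
    (hr : 0 < specRadius Q) {φ : B} (hφ : L.IsNonneg φ) (hφ0 : φ ≠ 0)
    (hφQ : Q φ = (specRadius Q : ℂ) • φ) :
    ∃ ψ : B →L[ℂ] ℂ, L.IsNonnegDual ψ ∧ ψ ≠ 0 ∧ ψ.comp Q = (specRadius Q : ℂ) • ψ := by
  obtain ⟨m, F, hF, hS⟩ := hqc.exists_pow_sub_lt
  obtain ⟨ψ₀, hψ₀, hpos⟩ := L.exists_isNonnegDual_pos hφ hφ0
  set r := specRadius Q with hrdef
  set t : ℕ → ℝ := fun k => r + 1 / ((k : ℝ) + 1) with ht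
  have hrt : ∀ k, r < t k := fun k => by
    have : 0 < 1 / ((k : ℝ) + 1) := by positivity
    simp only [ht]; linarith
  have hres : ∀ k, (t k : ℂ) ∈ resolventSet ℂ Q := fun k => mem_resolventSet_of_specRadius_lt (by
    rw [Complex.norm_real, Real.norm_of_nonneg (hr.trans (hrt k)).le]; exact hrt k)
  set p : ℕ → B →L[ℂ] ℂ := fun k => ψ₀.comp (resolvent Q (t k : ℂ)) with hp
  have hφn : 0 < ‖φ‖ := norm_pos_iff.2 hφ0
  have ha : 0 < ‖ψ₀ φ‖ := norm_pos_iff.2 hpos.ne'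
  -- R(t_k)φ = (k + 1)φ since t_k - r = 1/(k + 1). Testing on φ shows that ψ₀ ∘ R(t_k) blows up, as
  -- ψ₀(φ) > 0.
  have hlow : ∀ k : ℕ, ((k : ℝ) + 1) * (‖ψ₀ φ‖ / ‖φ‖) ≤ ‖p k‖ := fun k => by
    have h1 := resolvent_mul_sub (hres k) φ
    have hk : (0 : ℝ) < k + 1 := by positivity
    rw [hφQ, map_smul, ← sub_smul] at h1
    have h2 : (t k : ℂ) - (r : ℂ) = ((1 / ((k : ℝ) + 1) : ℝ) : ℂ) := by
      simp only [ht]; push_cast; ring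
    have h3 : p k φ = (((k : ℝ) + 1 : ℝ) : ℂ) * ψ₀ φ := by
      conv_rhs => rw [← h1, map_smul, h2, smul_eq_mul, ← mul_assoc, ← Complex.ofReal_mul,
        mul_one_div_cancel hk.ne', Complex.ofReal_one, one_mul]
      rfl
    have h4 := (p k).le_opNorm φ
    rw [h3, norm_mul, Complex.norm_real, Real.norm_of_nonneg hk.le] at h4
    rwa [← mul_div_assoc, div_le_iff₀ hφn]
  have hppos : ∀ k, 0 < ‖p k‖ := fun k => lt_of_lt_of_le (by positivity) (hlow k)
  set ψ : ℕ → B →L[ℂ] ℂ := fun k => ((‖p k‖⁻¹ : ℝ) : ℂ) • p k with hψ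
  have hψ1 : ∀ k, ‖ψ k‖ = 1 := fun k => by
    rw [hψ, norm_smul, Complex.norm_real, Real.norm_of_nonneg (by positivity),
      inv_mul_cancel₀ (hppos k).ne']
  have hψnn : ∀ k, L.IsNonnegDual (ψ k) := fun k f hf => by
    have h1 := hψ₀ _ (hQ.resolvent_nonneg (hrt k) f hf)
    refine mul_nonneg ?_ h1
    rw [Complex.zero_le_real]
    positivity
  have htlim : Tendsto (fun k => (t k : ℂ)) atTop (𝓝 (r : ℂ)) := by
    have h1 : Tendsto t atTop (𝓝 (r + 0)) :=
      tendsto_const_nhds.add tendsto_one_div_add_atTop_nhds_zero_nat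
    rw [add_zero] at h1
    exact (Complex.continuous_ofReal.tendsto r).comp h1
  have happ : Tendsto (fun k => (t k : ℂ) • ψ k - (ψ k).comp Q) atTop (𝓝 0) := by
    have h1 : Tendsto (fun k : ℕ => (‖ψ₀ φ‖ / ‖φ‖)⁻¹ * ‖ψ₀‖ * (1 / ((k : ℝ) + 1))) atTop
        (𝓝 0) := by
      simpa using (tendsto_one_div_add_atTop_nhds_zero_nat (𝕜 := ℝ)).const_mul
        ((‖ψ₀ φ‖ / ‖φ‖)⁻¹ * ‖ψ₀‖)
    refine squeeze_zero_norm (fun k => ?_) h1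
    have h2 : (t k : ℂ) • ψ k - (ψ k).comp Q = ((‖p k‖⁻¹ : ℝ) : ℂ) • ψ₀ := by
      ext f
      have h3 := congrArg ψ₀ (resolvent_mul_sub (hres k) f)
      rw [map_sub, map_smul] at h3
      rw [smul_apply, ← h3]
      simp [hψ, hp]
      ring
    rw [h2, norm_smul, Complex.norm_real, Real.norm_of_nonneg (by positivity)]
    calc ‖p k‖⁻¹ * ‖ψ₀‖ ≤ (((k : ℝ) + 1) * (‖ψ₀ φ‖ / ‖φ‖))⁻¹ * ‖ψ₀‖ := by
          gcongr
          exact hlow k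
      _ = (‖ψ₀ φ‖ / ‖φ‖)⁻¹ * ‖ψ₀‖ * (1 / ((k : ℝ) + 1)) := by rw [mul_inv]; ring
  obtain ⟨q, U, hq, hq0, hqQ⟩ := exists_eigenform_of_approx (r := (r : ℂ)) hF (by
    rw [norm_pow, Complex.norm_real, Real.norm_of_nonneg hr.le]; exact hS) htlim hψ1 happ
  exact ⟨q, fun f hf => ge_of_tendsto (hq f) (Eventually.of_forall fun k => hψnn k f hf),
    hq0, hqQ⟩

end FunctionLattice

/-! ### The simple pole, by splitting off a rank one projection. -/

section Pole

open Topology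

variable {B : Type*} [NormedAddCommGroup B] [NormedSpace ℂ B]

/-- A spectral value of a quasi-compact operator that is a limit of points of the resolvent set is
an eigenvalue. -/
theorem exists_eigenvector_of_mem_spectrum [CompleteSpace B] {Q F : B →L[ℂ] B} {m : ℕ} {r : ℂ}
    (hF : IsCompactOperator F) (hS : ‖Q ^ m - F‖ < ‖r ^ m‖) (hr : r ∈ spectrum ℂ Q)
    {t : ℕ → ℂ} (ht : Tendsto t atTop (𝓝 r)) (htρ : ∀ n, t n ∈ resolventSet ℂ Q) :
    ∃ y : B, y ≠ 0 ∧ Q y = r • y := by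
  have hne : ∀ n, 0 < ‖r - t n‖ := fun n => by
    rw [norm_pos_iff, sub_ne_zero]
    rintro rfl
    exact hr (htρ n)
  have hg : ∀ n, ∃ g : B, ‖g‖ ≤ 1 ∧ (2 * ‖r - t n‖)⁻¹ < ‖resolvent Q (t n) g‖ := by
    intro n
    have h1 := one_le_dist_mul_norm_resolvent hr (htρ n)
    have h2 : (2 * ‖r - t n‖)⁻¹ < ‖resolvent Q (t n)‖ := by
      have := hne n
      rw [inv_lt_iff_one_lt_mul₀ (by positivity)]
      linarith
    obtain ⟨f, hf, hf'⟩ := ContinuousLinearMap.exists_lt_apply_of_lt_opNorm _ h2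
    exact ⟨f, hf.le, hf'⟩
  choose g hg1 hg2 using hg
  have hypos : ∀ n, 0 < ‖resolvent Q (t n) (g n)‖ := fun n =>
    lt_of_le_of_lt (by positivity) (hg2 n)
  set x : ℕ → B := fun n => ((‖resolvent Q (t n) (g n)‖⁻¹ : ℝ) : ℂ) • resolvent Q (t n) (g n)
    with hx
  have hx1 : ∀ n, ‖x n‖ = 1 := fun n => by
    rw [hx, norm_smul, Complex.norm_real, Real.norm_of_nonneg (by positivity),
      inv_mul_cancel₀ (hypos n).ne']
  have happ : Tendsto (fun n => t n • x n - Q (x n)) atTop (𝓝 0) := by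
    have h1 : Tendsto (fun n => 2 * ‖r - t n‖) atTop (𝓝 0) := by
      simpa using ((tendsto_const_nhds (x := r)).sub ht).norm.const_mul 2
    refine squeeze_zero_norm (fun n => ?_) h1
    have h2 : t n • x n - Q (x n) = ((‖resolvent Q (t n) (g n)‖⁻¹ : ℝ) : ℂ) • g n := by
      simp only [hx, map_smul]
      rw [smul_comm, ← smul_sub, resolvent_sub_mul (htρ n)]
    rw [h2, norm_smul, Complex.norm_real, Real.norm_of_nonneg (by positivity)]
    have := hne n
    calc ‖resolvent Q (t n) (g n)‖⁻¹ * ‖g n‖ ≤ ((2 * ‖r - t n‖)⁻¹)⁻¹ * 1 := by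
          gcongr
          · exact (hg2 n).le
          · exact hg1 n
      _ = 2 * ‖r - t n‖ := by rw [mul_one, inv_inv]
  obtain ⟨y, -, -, -, hy0, hy⟩ := exists_tendsto_of_approx_eigenvector hF hS ht hx1 happ
  exact ⟨y, hy0, hy⟩

/-- Lets the compact-plus-small decomposition of Q^m pass to (Q - K)^m with the same small part. -/
theorem isCompactOperator_pow_sub_pow {Q K : B →L[ℂ] B} (hK : IsCompactOperator K) (m : ℕ) :
    IsCompactOperator (Q ^ m - (Q - K) ^ m : B →L[ℂ] B) := by
  induction m with
  | zero => simpa using isCompactOperator_zero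
  | succ m ih =>
    have h : Q ^ (m + 1) - (Q - K) ^ (m + 1) = Q ^ m * K + (Q ^ m - (Q - K) ^ m) * (Q - K) := by
      rw [pow_succ, pow_succ]; noncomm_ring
    rw [h]
    exact (hK.clm_comp (Q ^ m)).add (ih.comp_clm (Q - K))

/-- The resolvent of a quasi-compact operator has a simple pole at an eigenvalue that is split off
by a rank one spectral projection. -/
theorem IsQuasiCompact.isPoleOfOrder_one [CompleteSpace B] {Q : B →L[ℂ] B}
    (hqc : IsQuasiCompact Q) (hr : 0 < specRadius Q) {φ : B} {ψ : B →L[ℂ] ℂ} (hψφ : ψ φ = 1)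
    (hφ : Q φ = (specRadius Q : ℂ) • φ) (hψ : ψ.comp Q = (specRadius Q : ℂ) • ψ)
    (hker : ∀ h : B, Q h = (specRadius Q : ℂ) • h → ψ h = 0 → h = 0) :
    IsPoleOfOrder Q (specRadius Q : ℂ) 1 := by
  obtain ⟨m, F, hF, hS⟩ := hqc.exists_pow_sub_lt
  have hρ : ∀ z : ℂ, specRadius Q < ‖z‖ → z ∈ resolventSet ℂ Q :=
    fun z => mem_resolventSet_of_specRadius_lt
  have hrn : ‖((specRadius Q : ℝ) : ℂ)‖ = specRadius Q := by
    rw [Complex.norm_real, Real.norm_of_nonneg hr.le]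
  have hS' : ‖Q ^ m - F‖ < ‖((specRadius Q : ℝ) : ℂ) ^ m‖ := by rwa [norm_pow, hrn]
  have hr0 : ((specRadius Q : ℝ) : ℂ) ≠ 0 := by exact_mod_cast hr.ne'
  have htρ : ∀ n : ℕ, ((specRadius Q + 1 / ((n : ℝ) + 1) : ℝ) : ℂ) ∈ resolventSet ℂ Q := by
    intro n
    have : 0 < 1 / ((n : ℝ) + 1) := by positivity
    apply hρ
    rw [Complex.norm_real, Real.norm_of_nonneg (by positivity)]
    linarith
  have htlim : Tendsto (fun n : ℕ => ((specRadius Q + 1 / ((n : ℝ) + 1) : ℝ) : ℂ)) atTop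
      (𝓝 ((specRadius Q : ℝ) : ℂ)) := by
    have h1 : Tendsto (fun n : ℕ => specRadius Q + 1 / ((n : ℝ) + 1)) atTop
        (𝓝 (specRadius Q + 0)) :=
      tendsto_const_nhds.add tendsto_one_div_add_atTop_nhds_zero_nat
    rw [add_zero] at h1
    exact (Complex.continuous_ofReal.tendsto _).comp h1
  have htne : ∀ n : ℕ, ((specRadius Q + 1 / ((n : ℝ) + 1) : ℝ) : ℂ) ≠ 0 := fun n => by
    have : specRadius Q + 1 / ((n : ℝ) + 1) ≠ 0 := by positivity
    exact_mod_cast this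
  generalize ((specRadius Q : ℝ) : ℂ) = r at *
  set E : B →L[ℂ] B := ψ.smulRight φ with hE
  have hEf : ∀ f, E f = ψ f • φ := fun f => rfl
  have hψQ : ∀ f, ψ (Q f) = r * ψ f := fun f => congrArg (fun T : B →L[ℂ] ℂ => T f) hψ
  have hEE : E * E = E := by
    ext f
    simp [hEf, hψφ]
  have hEc : IsCompactOperator E := by
    have h1 : IsCompactOperator ψ := isCompactOperator_of_locallyCompactSpace_dom ψ
    exact h1.clm_comp ((1 : ℂ →L[ℂ] ℂ).smulRight φ)
  set T : B →L[ℂ] B := Q - r • E with hT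
  have hTf : ∀ f, T f = Q f - r • ψ f • φ := fun f => rfl
  have hTφ : T φ = 0 := by rw [hTf, hφ, hψφ, one_smul, sub_self]
  -- E is a projection with TE = ET = 0, so z - Q = z - T - rE factors, in either order.
  have hfac1 : ∀ z : ℂ, z ≠ 0 → algebraMap ℂ (B →L[ℂ] B) z - Q =
      (algebraMap ℂ (B →L[ℂ] B) z - T) * (1 - (r / z) • E) := by
    intro z hz
    ext f
    simp only [Algebra.algebraMap_eq_smul_one, mul_apply_eq_comp, sub_apply, smul_apply,
      one_apply_eq_self, map_sub, map_smul, hEf, hTφ, hTf f, sub_zero, smul_smul]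
    rw [show r / z * ψ f * z = r * ψ f by field_simp]
    abel
  have hfac2 : ∀ z : ℂ, z ≠ 0 → algebraMap ℂ (B →L[ℂ] B) z - Q =
      (1 - (r / z) • E) * (algebraMap ℂ (B →L[ℂ] B) z - T) := by
    intro z hz
    ext f
    simp only [Algebra.algebraMap_eq_smul_one, mul_apply_eq_comp, sub_apply, smul_apply,
      one_apply_eq_self, map_sub, map_smul, hEf, hTf, smul_smul, hψQ, hψφ, mul_one]
    match_scalars <;> field_simp
    ring
  -- Otherwise r is an eigenvalue of T. Since ψ ∘ T = 0, its eigenvector y has ψ(y) = 0, hence Qy =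
  -- ry, and `hker` gives y = 0.
  have hrT : r ∈ resolventSet ℂ T := by
    by_contra hmem
    have hd : T ^ m - (F - (Q ^ m - T ^ m)) = Q ^ m - F := by abel
    obtain ⟨y, hy0, hy⟩ := exists_eigenvector_of_mem_spectrum (Q := T) (m := m) (r := r)
      (F := F - (Q ^ m - T ^ m))
      (hF.sub (isCompactOperator_pow_sub_pow (hEc.smul r) m))
      (by rw [hd]; exact hS') hmem htlim (fun n => by
        have h1 : IsUnit _ := htρ n
        rw [hfac1 _ (htne n)] at h1
        exact ((Commute.isUnit_mul_iff ((hfac1 _ (htne n)).symm.trans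
          (hfac2 _ (htne n)))).1 h1).1)
    have h1 : ψ y = 0 := by
      have h2 := congrArg ψ hy
      rw [hTf, map_sub, hψQ, map_smul, map_smul, hψφ, map_smul] at h2
      simp at h2
      exact h2.resolve_left hr0
    apply hy0
    apply hker y _ h1
    rw [← hy, hTf, h1]
    simp
  have hev : ∀ᶠ z in 𝓝[≠] r, resolvent Q z =
      (z - r) ^ (-1 : ℤ) • ((z - r) • resolvent T z + r • (E * resolvent T z)) := by
    rw [eventually_nhdsWithin_iff]
    filter_upwards [eventually_ne_nhds hr0] with z hz0 hzr
    have hzr : z - r ≠ 0 := sub_ne_zero.2 hzr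
    have h1 : (1 - (r / z) • E) * (1 + (r / (z - r)) • E) = 1 ∧
        (1 + (r / (z - r)) • E) * (1 - (r / z) • E) = 1 := by
      -- As E² = E, (1 - aE)(1 + bE) = 1 + (b - a - ab)E, and b = r/(z - r) solves b - a - ab = 0
      -- for a = r/z.
      have hab : r / (z - r) - r / z - r / z * (r / (z - r)) = 0 := by field_simp; ring
      constructor
      · have : (1 - (r / z) • E) * (1 + (r / (z - r)) • E) =
            1 + (r / (z - r) - r / z - r / z * (r / (z - r))) • E := by
          simp only [sub_mul, mul_add, one_mul, mul_one, smul_mul_smul_comm, hEE, sub_smul]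
          abel
        rw [this, hab, zero_smul, add_zero]
      · have : (1 + (r / (z - r)) • E) * (1 - (r / z) • E) =
            1 + (r / (z - r) - r / z - r / z * (r / (z - r))) • E := by
          simp only [add_mul, mul_sub, one_mul, mul_one, smul_mul_smul_comm, hEE, sub_smul,
            mul_comm (r / z)]
          abel
        rw [this, hab, zero_smul, add_zero]
    have h2 : Ring.inverse (1 - (r / z) • E) = 1 + (r / (z - r)) • E :=
      Ring.inverse_unit ⟨_, _, h1.1, h1.2⟩
    rw [resolvent, hfac1 z hz0, Ring.inverse_mul (Or.inr ⟨⟨_, _, h1.1, h1.2⟩, rfl⟩), h2,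
      zpow_neg_one, smul_add, smul_smul, smul_smul, inv_mul_cancel₀ hzr, one_smul, add_mul,
      one_mul, smul_mul_assoc, div_eq_inv_mul]
    rfl
  have hRT : AnalyticAt ℂ (fun z : ℂ => resolvent T z) r := by
    refine DifferentiableOn.analyticAt (s := resolventSet ℂ T) (fun z hz => ?_)
      ((spectrum.isOpen_resolventSet T).mem_nhds hrT)
    exact (spectrum.hasDerivAt_resolvent_const_left hz).differentiableAt.differentiableWithinAt
  have hg : AnalyticAt ℂ (fun z : ℂ => (z - r) • resolvent T z + r • (E * resolvent T z)) r :=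
    ((analyticAt_id.fun_sub analyticAt_const).fun_smul hRT).fun_add
      (analyticAt_const.fun_smul (analyticAt_const.fun_mul hRT))
  -- Tφ = 0 gives r R_T(r)φ = φ, so ψ takes the value 1 on the image of φ: the pole is not
  -- removable.
  have hg0 : (r - r) • resolvent T r + r • (E * resolvent T r) ≠ 0 := by
    intro h0
    have h1 := resolvent_mul_sub hrT φ
    rw [hTφ, map_zero, sub_zero] at h1
    have h2 := congrArg (fun S : B →L[ℂ] B => ψ (S φ)) h0
    simp only [sub_self, zero_smul, zero_add, smul_apply, mul_apply_eq_comp] at h2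
    rw [← map_smul E, h1, hEf, map_smul, hψφ] at h2
    simp at h2
  have hmer : MeromorphicAt (fun z : ℂ => resolvent Q z) r := by
    refine MeromorphicAt.congr (f := fun z : ℂ =>
      (z - r) ^ (-1 : ℤ) • ((z - r) • resolvent T z + r • (E * resolvent T z))) ?_
      (hev.mono fun z hz => hz.symm)
    exact ((analyticAt_id.sub analyticAt_const).meromorphicAt.zpow (-1)).smul hg.meromorphicAt
  exact ⟨one_pos, hmer, (meromorphicOrderAt_eq_int_iff hmer).2 ⟨_, hg, hg0, hev⟩⟩

end Pole

/-! ### Peripheral eigenvalues: moduli, equality cases and constancy of the phase. -/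

theorem laplaceWeight_nonneg (γ : ℝ≥0∞) (t : ℝ≥0) : 0 ≤ laplaceWeight γ t := by
  unfold laplaceWeight
  split_ifs <;> positivity

/-- The equality case of `|∫ f| ≤ ∫ |f|`. -/
theorem ae_eq_mul_norm_of_integral_eq {Y : Type*} [MeasurableSpace Y] {ν : Measure Y} {f : Y → ℂ}
    (hf : Integrable f ν) {a : ℂ} (ha : ‖a‖ = 1) {R : ℝ} (h1 : ∫ y, f y ∂ν = a * R)
    (h2 : ∫ y, ‖f y‖ ∂ν = R) : ∀ᵐ y ∂ν, f y = a * ‖f y‖ := by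
  have haa : (starRingEnd ℂ) a * a = 1 := by
    rw [Complex.conj_mul', ha]; simp
  have hi : Integrable (fun y => (starRingEnd ℂ) a * f y) ν := hf.const_mul _
  have hire : Integrable (fun y => ((starRingEnd ℂ) a * f y).re) ν := hi.re
  -- The integrand |f| - Re(conj(a) f) is nonnegative with zero integral, so conj(a) f is almost
  -- everywhere equal to its modulus.
  have h3 : ∫ y, (‖f y‖ - ((starRingEnd ℂ) a * f y).re) ∂ν = 0 := by
    have h4 : ∫ y, ((starRingEnd ℂ) a * f y).re ∂ν = R := by
      have := integral_re hi
      simp only [RCLike.re_to_complex] at this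
      rw [this, integral_const_mul, h1, ← mul_assoc, haa, one_mul, Complex.ofReal_re]
    rw [integral_sub hf.norm hire, h2, h4, sub_self]
  have hn : ∀ y, ‖(starRingEnd ℂ) a * f y‖ = ‖f y‖ := fun y => by
    rw [norm_mul, RCLike.norm_conj, ha, one_mul]
  rw [integral_eq_zero_iff_of_nonneg (fun y => sub_nonneg.2 (by
    rw [← hn y]; exact Complex.re_le_norm _)) (hf.norm.sub hire)] at h3
  filter_upwards [h3] with y hy
  have h5 : ((starRingEnd ℂ) a * f y).re = ‖(starRingEnd ℂ) a * f y‖ := by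
    rw [hn]; exact (sub_eq_zero.1 hy).symm
  have h6 := RCLike.norm_of_nonneg' (Complex.re_eq_norm.1 h5)
  have h6 : (‖f y‖ : ℂ) = (starRingEnd ℂ) a * f y := by rw [← hn]; exact h6
  rw [h6, ← mul_assoc, mul_comm a, haa, one_mul]

namespace FunctionLattice

open Topology

variable {X : Type*} {l : Filter X} {B : Type*} [NormedAddCommGroup B] [NormedSpace ℂ B]

theorem abs_ne_zero (L : FunctionLattice l B) {f : B} (hf : f ≠ 0) : L.abs f ≠ 0 := by
  rw [← norm_ne_zero_iff, L.norm_abs, norm_ne_zero_iff]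
  exact hf

/-- If a nonnegative operator has a positive eigenform for `r`, then the modulus of an eigenvector
for an eigenvalue of modulus `r` is an eigenvector for `r`. -/
theorem IsNonnegOperator.map_abs_eq [CountableInterFilter l] {L : FunctionLattice l B}
    {Q : B →L[ℂ] B} (hQ : L.IsNonnegOperator Q) {r : ℝ} {ψ : B →L[ℂ] ℂ} (hψ : L.IsPosDual ψ)
    (hψQ : ψ.comp Q = (r : ℂ) • ψ) {lam : ℂ} {h : B} (hlam : ‖lam‖ = r) (hh : Q h = lam • h) :
    Q (L.abs h) = (r : ℂ) • L.abs h := by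
  -- r|h| = |Qh| ≤ Q|h|. The difference is killed by ψ, so it is null.
  have h1 : L.IsNonneg (Q (L.abs h) - (r : ℂ) • L.abs h) := by
    rw [isNonneg_iff]
    have h0 := hQ _ (L.isNonneg_abs h)
    rw [isNonneg_iff] at h0
    have h2 := hQ.norm_rep_le h
    rw [hh] at h2
    filter_upwards [h0, h2, L.rep_sub (Q (L.abs h)) ((r : ℂ) • L.abs h), L.rep_smul r (L.abs h),
      L.rep_abs h, L.rep_smul lam h] with x h0 h1 h2 h3 h4 h5
    rw [h5, norm_mul, hlam] at h1
    rw [h2, h3, h4, sub_nonneg, ← Complex.ofReal_mul]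
    obtain ⟨h6, h7⟩ := Complex.nonneg_iff.1 h0
    exact Complex.le_def.2 ⟨by simpa using h1, by simpa using h7⟩
  by_contra hne
  have h2 := hψ _ h1 (sub_ne_zero.2 hne)
  have h3 := congrArg (fun T : B →L[ℂ] ℂ => T (L.abs h)) hψQ
  rw [map_sub, map_smul] at h2
  simp only [ContinuousLinearMap.comp_apply, smul_apply] at h3
  rw [h3, sub_self] at h2
  exact lt_irrefl _ h2

/-- For a strictly positive operator with a positive eigenform, the eigenform does not vanish on
nonzero eigenvectors. -/
theorem IsNonnegOperator.eq_zero_of_eigenform_eq_zero [CountableInterFilter l]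
    {L : FunctionLattice l B} {Q : B →L[ℂ] B} (hQ : L.IsNonnegOperator Q)
    (hQpos : ∀ f : B, L.IsNonneg f → f ≠ 0 → L.IsPos (Q f)) {r : ℝ} (hr : 0 < r)
    {ψ : B →L[ℂ] ℂ} (hψ : L.IsPosDual ψ) (hψQ : ψ.comp Q = (r : ℂ) • ψ) {h : B}
    (hh : Q h = (r : ℂ) • h) (hψh : ψ h = 0) : h = 0 := by
  have hψn : L.IsNonnegDual ψ := fun f hf => by
    by_cases hf0 : f = 0
    · rw [hf0, map_zero]
    · exact (hψ f hf hf0).le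
  -- |k| - k is a nonnegative fixed vector of Q/r: either it is zero and k ≥ 0, or strict positivity
  -- makes it positive and k < 0. A signed k with ψ(k) = 0 is zero.
  have real_case : ∀ k : B, L.IsReal k → Q k = (r : ℂ) • k → ψ k = 0 → k = 0 := by
    intro k hkr hk hψk
    have h1 := hQ.map_abs_eq hψ hψQ (lam := (r : ℂ)) (by
      rw [Complex.norm_real, Real.norm_of_nonneg hr.le]) hk
    have h2 : L.IsNonneg (L.abs k - k) := by
      rw [isNonneg_iff]
      filter_upwards [hkr, L.rep_sub (L.abs k) k, L.rep_abs k] with x h1 h2 h3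
      rw [h2, h3, sub_nonneg]
      exact Complex.le_def.2 ⟨by simpa using Complex.re_le_norm _, by simpa using h1⟩
    by_cases h0 : L.abs k - k = 0
    · by_contra hk0
      have h3 := hψ _ (L.isNonneg_abs k) (L.abs_ne_zero hk0)
      rw [sub_eq_zero.1 h0, hψk] at h3
      exact lt_irrefl _ h3
    · have h3 := hQpos _ h2 h0
      rw [map_sub, h1, hk, ← smul_sub] at h3
      rw [isPos_iff] at h3
      have h4 : L.IsNonneg (-k) := by
        rw [isNonneg_iff]
        filter_upwards [h3, hkr, L.rep_smul r (L.abs k - k), L.rep_sub (L.abs k) k, L.rep_abs k,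
          L.rep_neg k] with x h1 h2 h3 h4 h5 h6
        rw [h3, h4, h5] at h1
        have h7 := (Complex.pos_iff.1 h1).1
        rw [Complex.re_ofReal_mul, Complex.sub_re, Complex.ofReal_re,
          mul_pos_iff_of_pos_left hr, sub_pos] at h7
        have h8 := h7.trans_le (Complex.norm_le_abs_re_add_abs_im _)
        rw [h2, _root_.abs_zero, add_zero] at h8
        have h9 : (L.rep k x).re < 0 := by
          by_contra! h9
          rw [abs_of_nonneg h9] at h8
          exact lt_irrefl _ h8
        rw [h6]
        exact Complex.nonneg_iff.2 ⟨by rw [Complex.neg_re]; linarith, by simp [h2]⟩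
      by_contra hk0
      have h5 := hψ _ h4 (neg_ne_zero.2 hk0)
      rw [map_neg, hψk, neg_zero] at h5
      exact lt_irrefl _ h5
  have hdec := L.re_add_I_smul h
  have hQre : ∀ k : B, Q k = (r : ℂ) • k → Q (L.re k) = (r : ℂ) • L.re k := by
    intro k hk
    rw [hQ.map_re, hk]
    apply L.ext_rep
    filter_upwards [L.rep_re ((r : ℂ) • k), L.rep_smul r k, L.rep_smul r (L.re k), L.rep_re k]
      with x h1 h2 h3 h4
    rw [h1, h2, h3, h4, Complex.re_ofReal_mul, Complex.ofReal_mul]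
  have h1 := hψn.im_eq_zero h
  have h2 := hψn.im_eq_zero (-Complex.I • h)
  have h3 := hψh
  rw [← hdec, map_add, map_smul] at h3
  have h4 : ψ (L.re h) = 0 := by
    refine Complex.ext ?_ h1
    have := congrArg Complex.re h3
    rwa [Complex.add_re, smul_eq_mul, Complex.I_mul_re, h2, neg_zero, add_zero] at this
  have h5 : ψ (L.re (-Complex.I • h)) = 0 := by
    refine Complex.ext ?_ h2
    have := congrArg Complex.im h3
    rwa [Complex.add_im, smul_eq_mul, Complex.I_mul_im, h1, zero_add] at this
  rw [← hdec, real_case _ (L.isReal_re _) (hQre h hh) h4,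
    real_case _ (L.isReal_re _) (hQre _ (by rw [map_smul, hh, smul_comm])) h5]
  simp

/-- A strictly positive kernel operator has no other eigenvalue of modulus `r` than `r`. Strict
positivity forces `g = u / |u|` to converge along `l` to `c * (r / lam)` for every cluster value `c`
of `g`, so that no aperiodicity assumption is needed. -/
theorem eq_of_eigenvalue_of_isLaplaceOperator [MeasurableSpace X] [l.NeBot]
    {L : FunctionLattice l B} {Q : B →L[ℂ] B}
    (hQpos : ∀ f : B, L.IsNonneg f → f ≠ 0 → L.IsPos (Q f)) {P : Kernel X X} {ξ : X → ℝ≥0}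
    {γ : ℝ≥0∞} (hP : IsLaplaceOperator L Q P ξ γ) {r : ℝ} (hr : 0 < r) {lam : ℂ}
    (hlam : ‖lam‖ = r) {h : B} (h0 : h ≠ 0) (hh : Q h = lam • h)
    (habs : Q (L.abs h) = (r : ℂ) • L.abs h) : lam = r := by
  set u := L.rep h with hu
  set w : X → ℝ := fun y => laplaceWeight γ (ξ y) with hw
  have hw0 : ∀ y, 0 ≤ w y := fun y => laplaceWeight_nonneg _ _
  have hrC : (r : ℂ) ≠ 0 := by exact_mod_cast hr.ne'
  have hlam0 : lam ≠ 0 := norm_pos_iff.1 (by rw [hlam]; exact hr)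
  have hupos : ∀ᶠ x in l, 0 < ‖u x‖ := by
    have h1 := hQpos _ (L.isNonneg_abs h) (L.abs_ne_zero h0)
    rw [habs, isPos_iff] at h1
    filter_upwards [h1, L.rep_smul r (L.abs h), L.rep_abs h] with x h1 h2 h3
    rw [norm_pos_iff]
    intro h4
    rw [h2, h3, ← hu, h4] at h1
    simp at h1
  obtain ⟨hint, hQh⟩ := hP h u (L.isRep_rep h)
  obtain ⟨-, hQa⟩ := hP (L.abs h) (fun y => ((‖u y‖ : ℝ) : ℂ)) (L.isRep_iff.2 (L.rep_abs h))
  rw [hh, isRep_iff] at hQh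
  rw [habs, isRep_iff] at hQa
  set a : X → ℂ := fun x => lam * u x / (r * ‖u x‖) with ha
  have hax : ∀ x, 0 < ‖u x‖ → ‖a x‖ = 1 := fun x hx => by
    simp only [ha]
    rw [norm_div, norm_mul, norm_mul, hlam, Complex.norm_real, Real.norm_of_nonneg hr.le,
      Complex.norm_real, norm_norm, div_self (by positivity)]
  -- Equality case of |∫ f| ≤ ∫ |f|: under P(x, ·) the function w u has the constant phase a(x),
  -- which is lam/r times the phase of u(x).
  have key : ∀ᶠ x in l, ∀ᵐ y ∂(P x), (w y : ℂ) * u y = a x * ((w y * ‖u y‖ : ℝ) : ℂ) := by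
    filter_upwards [hint, hQh, hQa, L.rep_smul lam h, L.rep_smul r (L.abs h), L.rep_abs h, hupos]
      with x h1 h2 h3 h4 h5 h6 h7
    have hux : (‖u x‖ : ℂ) ≠ 0 := by exact_mod_cast h7.ne'
    have hn : ∀ y, ‖(w y : ℂ) * u y‖ = w y * ‖u y‖ := fun y => by
      rw [norm_mul, Complex.norm_real, Real.norm_of_nonneg (hw0 y)]
    have e1 : ∫ y, (w y : ℂ) * u y ∂(P x) = a x * ((r * ‖u x‖ : ℝ) : ℂ) := by
      rw [← h2, h4, Complex.ofReal_mul]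
      simp only [ha]
      rw [div_mul_cancel₀ _ (mul_ne_zero hrC hux)]
    have e2 : ∫ y, ‖(w y : ℂ) * u y‖ ∂(P x) = r * ‖u x‖ := by
      rw [h5, h6] at h3
      simp only [hn]
      have h8 : ∫ y, ((w y * ‖u y‖ : ℝ) : ℂ) ∂(P x) = ((r * ‖u x‖ : ℝ) : ℂ) := by
        push_cast
        exact h3.symm
      rw [integral_complex_ofReal] at h8
      exact_mod_cast h8
    filter_upwards [ae_eq_mul_norm_of_integral_eq h1 (hax x h7) e1 e2] with y hy
    rw [← hn]
    exact hy
  -- Test Q on f = (Re(conj(c) u) - s|u|)⁺. If f is nonnull then Qf > 0; but w f vanishes P(x,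
  -- ·)-almost everywhere when Re(conj(c) a(x)) ≤ s, by constancy of the phase.
  have half : ∀ (c : ℂ) (s : ℝ),
      (∀ᶠ x in l, ((starRingEnd ℂ) c * u x).re ≤ s * ‖u x‖) ∨
        ∀ᶠ x in l, s < ((starRingEnd ℂ) c * a x).re := by
    intro c s
    set f := L.pos ((starRingEnd ℂ) c • h - (s : ℂ) • L.abs h) with hf
    have hrep : L.rep f =ᶠ[l]
        fun x => ((max (((starRingEnd ℂ) c * u x).re - s * ‖u x‖) 0 : ℝ) : ℂ) := by
      filter_upwards [L.rep_pos ((starRingEnd ℂ) c • h - (s : ℂ) • L.abs h),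
        L.rep_sub ((starRingEnd ℂ) c • h) ((s : ℂ) • L.abs h), L.rep_smul ((starRingEnd ℂ) c) h,
        L.rep_smul s (L.abs h), L.rep_abs h] with x h1 h2 h3 h4 h5
      rw [h1, h2, h3, h4, h5, Complex.sub_re, Complex.re_ofReal_mul, Complex.ofReal_re]
    by_cases hf0 : f = 0
    · left
      rw [hf0] at hrep
      filter_upwards [hrep, L.rep_zero] with x h1 h2
      rw [h2, eq_comm, Complex.ofReal_eq_zero] at h1
      have := le_max_left (((starRingEnd ℂ) c * u x).re - s * ‖u x‖) 0
      linarith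
    · right
      have hpos := hQpos f (L.isNonneg_pos _) hf0
      rw [isPos_iff] at hpos
      have hQf := (hP f _ (L.isRep_iff.2 hrep)).2
      rw [isRep_iff] at hQf
      filter_upwards [hpos, hQf, key] with x h1 h2 h3
      by_contra! hle
      rw [h2, integral_eq_zero_of_ae] at h1
      · exact lt_irrefl _ h1
      filter_upwards [h3] with y hy
      change (w y : ℂ) * _ = 0
      rw [← Complex.ofReal_mul, Complex.ofReal_eq_zero, mul_max_of_nonneg _ _ (hw0 y), mul_zero,
        max_eq_right_iff]
      have h4 : w y * ((starRingEnd ℂ) c * u y).re = w y * ‖u y‖ * ((starRingEnd ℂ) c * a x).re := by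
        rw [← Complex.re_ofReal_mul, mul_left_comm, hy, ← mul_assoc, mul_comm, Complex.re_ofReal_mul]
      have h5 : 0 ≤ w y * ‖u y‖ := mul_nonneg (hw0 y) (norm_nonneg _)
      rw [mul_sub, h4]
      nlinarith
  -- a cluster value `c` of `u / |u|`
  obtain ⟨c, hc1, hc⟩ : ∃ c : ℂ, ‖c‖ = 1 ∧ ClusterPt c (map (fun x => u x / ‖u x‖) l) := by
    obtain ⟨c, hc, hc'⟩ := (isCompact_sphere (0 : ℂ) 1).exists_clusterPt
      (f := map (fun x => u x / ‖u x‖) l) (by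
        rw [le_principal_iff, mem_map]
        filter_upwards [hupos] with x hx
        simp [hx.ne'])
    exact ⟨c, by simpa using hc, hc'⟩
  have hcc : (starRingEnd ℂ) c * c = 1 := by
    rw [Complex.conj_mul', hc1]; simp
  have hlim : Tendsto (fun x => u x / ‖u x‖) l (𝓝 (c * (r / lam))) := by
    -- At a cluster value c of u/|u|, the first alternative fails for every s < 1, because the
    -- sector of level s around c is visited frequently.
    have hconv : ∀ s < (1 : ℝ), ∀ᶠ x in l, s < ((starRingEnd ℂ) c * a x).re := by
      intro s hs
      refine (half c s).resolve_left fun hle => ?_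
      have hopen : {v : ℂ | s < ((starRingEnd ℂ) c * v).re} ∈ 𝓝 c := by
        refine (isOpen_lt continuous_const (by fun_prop)).mem_nhds ?_
        rw [Set.mem_ofPred_eq, hcc]
        exact hs
      have hfr := (hc.frequently hopen)
      rw [frequently_map] at hfr
      obtain ⟨x, h1, h2, h3⟩ := (hfr.and_eventually (hle.and hupos)).exists
      change s < ((starRingEnd ℂ) c * (u x / ‖u x‖)).re at h1
      rw [← mul_div_assoc, Complex.div_ofReal_re, lt_div_iff₀ h3] at h1
      linarith
    have hre : Tendsto (fun x => ((starRingEnd ℂ) c * a x).re) l (𝓝 1) := by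
      refine tendsto_order.2 ⟨hconv, fun b hb => ?_⟩
      filter_upwards [hupos] with x hx
      refine lt_of_le_of_lt (Complex.re_le_norm _) (lt_of_le_of_lt ?_ hb)
      rw [norm_mul, RCLike.norm_conj, hc1, one_mul, hax x hx]
    have hlim1 : Tendsto (fun x => (starRingEnd ℂ) c * a x) l (𝓝 1) := by
      rw [tendsto_iff_norm_sub_tendsto_zero]
      have h1 : Tendsto (fun x => Real.sqrt (2 - 2 * ((starRingEnd ℂ) c * a x).re)) l (𝓝 0) := by
        have := (Real.continuous_sqrt.tendsto _).comp
          ((hre.const_mul 2).const_sub 2)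
        simpa [Function.comp_def] using this
      refine h1.congr' ?_
      filter_upwards [hupos] with x hx
      have hn : ‖(starRingEnd ℂ) c * a x‖ = 1 := by
        rw [norm_mul, RCLike.norm_conj, hc1, one_mul, hax x hx]
      have hn2 : ((starRingEnd ℂ) c * a x).re ^ 2 + ((starRingEnd ℂ) c * a x).im ^ 2 = 1 := by
        rw [← one_pow 2, ← hn, ← Complex.normSq_eq_norm_sq, Complex.normSq_apply]; ring
      have hsq : 2 - 2 * ((starRingEnd ℂ) c * a x).re = ‖(starRingEnd ℂ) c * a x - 1‖ ^ 2 := by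
        rw [← Complex.normSq_eq_norm_sq, Complex.normSq_apply, Complex.sub_re, Complex.sub_im,
          Complex.one_re, Complex.one_im]
        linarith
      rw [hsq, Real.sqrt_sq (norm_nonneg _)]
    have h2 := hlim1.const_mul (c * (r / lam))
    rw [mul_one] at h2
    refine h2.congr' ?_
    filter_upwards [hupos] with x hx
    have hux : (‖u x‖ : ℂ) ≠ 0 := by exact_mod_cast hx.ne'
    simp only [ha]
    calc c * (r / lam) * ((starRingEnd ℂ) c * (lam * u x / (r * ‖u x‖)))
        = ((starRingEnd ℂ) c * c) * (u x / ‖u x‖) := by field_simp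
      _ = u x / ‖u x‖ := by rw [hcc, one_mul]
  -- The cluster value of a convergent function is its limit.
  have hceq : c = c * (r / lam) :=
    eq_of_nhds_neBot (hc.mono hlim)
  have hc0 : c ≠ 0 := norm_pos_iff.1 (by rw [hc1]; exact one_pos)
  have := mul_left_cancel₀ hc0 ((mul_one c).trans hceq)
  field_simp at this
  exact this

end FunctionLattice

/-! ### Assembly of the three claims. -/

theorem mainTheorem9 {X : Type*} [MeasurableSpace X] (l : Filter X)
    -- functions on `X`, or classes of functions modulo some nonnull measure `m`
    (hl : l = ⊤ ∨ ∃ m : Measure X, m ≠ 0 ∧ l = ae m)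
    {B : Type*} [NormedAddCommGroup B] [NormedSpace ℂ B] [CompleteSpace B] [Nontrivial B]
    (L : FunctionLattice l B) (Q : B →L[ℂ] B)
    (hQnonneg : L.IsNonnegOperator Q) (hQqc : IsQuasiCompact Q) (hQr : specRadius Q ≠ 0)
    (hQpos : ∀ f : B, L.IsNonneg f → f ≠ 0 →
      L.IsPos (Q f) ∧
      ∀ ψ : B →L[ℂ] ℂ, L.IsNonnegDual ψ → ψ ≠ 0 →
        ψ.comp Q = (specRadius Q : ℂ) • ψ → 0 < ψ (Q f)) :
    (IsPoleOfOrder Q (specRadius Q : ℂ) 1 ∧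
      ∃ (φ : B) (ψ : B →L[ℂ] ℂ), L.IsPos φ ∧ L.IsPosDual ψ ∧ ψ φ = 1 ∧
        Q φ = (specRadius Q : ℂ) • φ ∧ ψ.comp Q = (specRadius Q : ℂ) • ψ) ∧
    (∀ (lam : ℂ) (h : B), ‖lam‖ = specRadius Q → Q h = lam • h →
      Q (L.abs h) = (specRadius Q : ℂ) • L.abs h) ∧
    (∀ (P : Kernel X X) [IsMarkovKernel P] (π : Measure X) [IsProbabilityMeasure π]
      (ξ : X → ℝ≥0) (γ : ℝ≥0∞) (φ : B),
      Kernel.Invariant P π → Measurable ξ →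
      IsLaplaceOperator L Q P ξ γ →
      (∃ e : B, L.IsRep e fun _ => 1) → ContinuouslyIncludedInL1 L π →
      L.IsPos φ →
      LinearMap.ker (Q - (specRadius Q : ℂ) • ContinuousLinearMap.id ℂ B).toLinearMap
        = Submodule.span ℂ {φ} →
      (∀ lam : ℂ, ‖lam‖ = 1 → IsUnimodularEigenvalue L P π lam → lam = 1) →
      ∀ lam : ℂ, ‖lam‖ = specRadius Q →
        (Module.End.HasEigenvalue Q.toLinearMap lam ↔ lam = (specRadius Q : ℂ))) := by
  -- The only properties of `l` used from here on are this one and `l.NeBot`, which holds since B is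
  -- nonzero.
  have hcount : CountableInterFilter l := by
    rcases hl with rfl | ⟨m, -, rfl⟩
    · rw [← principal_univ]; infer_instance
    · infer_instance
  have hne : l.NeBot := by
    refine ⟨fun h => ?_⟩
    obtain ⟨f, hf⟩ := exists_ne (0 : B)
    subst h
    exact hf (L.eq_zero_of_rep eventually_bot)
  have hr : 0 < specRadius Q := lt_of_le_of_ne ENNReal.toReal_nonneg hQr.symm
  have hQpos1 : ∀ f : B, L.IsNonneg f → f ≠ 0 → L.IsPos (Q f) := fun f hf h0 => (hQpos f hf h0).1
  obtain ⟨φ, hφ, hφ0, hQφ⟩ := hQnonneg.exists_eigenvector hQqc hr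
  obtain ⟨p, hp, hp0, hpQ⟩ := hQnonneg.exists_eigenform hQqc hr hφ hφ0 hQφ
  have hrC : (0 : ℂ) < (specRadius Q : ℂ) := by exact_mod_cast hr
  have hφpos : L.IsPos φ := by
    have h1 := hQpos1 φ hφ hφ0
    rw [hQφ, FunctionLattice.isPos_iff] at h1
    rw [FunctionLattice.isPos_iff]
    filter_upwards [h1, L.rep_smul (specRadius Q) φ] with x h1 h2
    rw [h2] at h1
    exact (mul_pos_iff_of_pos_left hrC).1 h1
  -- r p(f) = p(Qf) > 0 by the hypothesis on nonnegative eigenforms.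
  have hppos : L.IsPosDual p := fun f hf hf0 => by
    have h1 := (hQpos f hf hf0).2 p hp hp0 hpQ
    have h2 : p (Q f) = (specRadius Q : ℂ) * p f := congrArg (fun T : B →L[ℂ] ℂ => T f) hpQ
    rw [h2] at h1
    exact (mul_pos_iff_of_pos_left hrC).1 h1
  have hpφ := hppos φ hφ hφ0
  set ψ : B →L[ℂ] ℂ := (p φ)⁻¹ • p with hψdef
  have hψpos : L.IsPosDual ψ := fun f hf hf0 => mul_pos (inv_pos.2 hpφ) (hppos f hf hf0)
  have hψφ : ψ φ = 1 := inv_mul_cancel₀ hpφ.ne'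
  have hψQ : ψ.comp Q = (specRadius Q : ℂ) • ψ := by
    rw [hψdef, ContinuousLinearMap.smul_comp, hpQ, smul_comm]
  have habs : ∀ (lam : ℂ) (h : B), ‖lam‖ = specRadius Q → Q h = lam • h →
      Q (L.abs h) = (specRadius Q : ℂ) • L.abs h :=
    fun lam h hlam hh => hQnonneg.map_abs_eq hψpos hψQ hlam hh
  refine ⟨⟨hQqc.isPoleOfOrder_one hr hψφ hQφ hψQ fun h hh hψh =>
    hQnonneg.eq_zero_of_eigenform_eq_zero hQpos1 hr hψpos hψQ hh hψh,
    φ, ψ, hφpos, hψpos, hψφ, hQφ, hψQ⟩, habs, ?_⟩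
  intro P _ π _ ξ γ _ _ _ hP _ _ _ _ _ lam hlam
  constructor
  · intro hev
    obtain ⟨h, hh⟩ := hev.exists_hasEigenvector
    have hQh : Q h = lam • h := hh.apply_eq_smul
    exact L.eq_of_eigenvalue_of_isLaplaceOperator hQpos1 hP hr hlam hh.2 hQh (habs lam h hlam hQh)
  · rintro rfl
    exact Module.End.hasEigenvalue_of_hasEigenvector
      (Module.End.hasEigenvector_iff.2 ⟨Module.End.mem_eigenspace_iff.2 hQφ, hφ0⟩)
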